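/- **Definitions.** Let $\mathbb F_q$ be a finite field. A CSS code of length $n$ over $\mathbb F_q$ is a pair $Q=(Q_X,Q_Z)$ of subspaces of $\mathbb F_q^n$ with $Q_X^\perp\subseteq Q_Z$; its dimension is $k=\dim Q_Z-\dim Q_X^\perp$, its rate is $k/n$, and its distance is the minimum Hamming weight of an element of $(Q_X\setminus Q_Z^\perp)\cup(Q_Z\setminus Q_X^\perp)$ ($\infty$ if this set is empty). Here an $[[N,K,D]]$ code is a CSS code of length $N$, dimension $K$ and distance at least $D$. A matrix $H\in\mathbb F_q^{m\times n}$ witnesses that a code $C\subseteq\mathbb F_q^n$ is locally testable with locality $\le w$ and soundness $\ge\rho$ if $C=\ker H$, every row and every column of $H$ has at most $w$ nonzero entries, and every $s\in\operatorname{im}H$ has some $e\in\mathbb F_q^n$ with $He=s$ and $|s|/m\ge\rho\,|e|/n$, where $|\cdot|$ is Hamming weight. A CSS code is locally testable with locality $\le w$ and soundness $\ge\rho$ if both $Q_X$ and $Q_Z$ have such a witness. A single-sector complex over $\mathbb F_q$ is a space $\mathbb F_q^n$ with a matrix $\partial$ satisfying $\partial^2=0$; its associated CSS code is $(\ker\partial^\top,\ker\partial)$.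 If $\mathbb F_q$ has characteristic $2$, the homological product of $(\mathbb F_q^{n_1},\partial_1)$ and $(\mathbb F_q^{n_2},\partial_2)$ is $\mathbb F_q^{n_1}\otimes\mathbb F_q^{n_2}$ with $\partial=\partial_1\otimes I+I\otimes\partial_2$. If $Q$ is a CSS code with $\dim Q_X=\dim Q_Z$ and $H_X,H_Z$ are parity-check matrices of $Q_X,Q_Z$ of full row rank, the resulting single-sector complex is $(\mathbb F_q^n,\;H_X^\top H_Z)$. **Statement.** For every $\epsilon>0$ there exist $\Delta=\Delta(\epsilon)>0$, $\rho=\rho(\epsilon)>0$ and a sequence $p(n)=p_\epsilon(n)$ with $p(n)\to1$ as $n\to\infty$ such that the following holds for every $n$, every finite field $\mathbb F_q$ of characteristic $2$, and all $R_1,R_2\le1-\epsilon$ for which length-$n$ CSS codes over $\mathbb F_q$ of rate $R_i$ with $\dim Q_X=\dim Q_Z$ exist ($i=1,2$). Let $Q^1,Q^2$ be independent, $Q^i$ uniformly random among the length-$n$, rate-$R_i$ CSS codes over $\mathbb F_q$ with $\dim Q^i_X=\dim Q^i_Z$. Then with probability at least $p(n)$, for every choice of full-rank parity-check matrices $H^i_X,H^i_Z$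 of $Q^i_X,Q^i_Z$ with resulting single-sector complexes $\mathcal C_i$, the CSS code associated to the homological product $\mathcal A=\mathcal C_1\otimes\mathcal C_2$ is an $$[[\,n^2,\;R_1R_2\,n^2,\;\Delta\,n^2\,]]$$ code that is locally testable with locality $\le 2n$ and soundness $\ge\rho$; moreover this is witnessed by the matrices $(\partial^{\mathcal A})^\top$ for $\ker\,(\partial^{\mathcal A})^\top$ and $\partial^{\mathcal A}$ for $\ker\partial^{\mathcal A}$. -/

import Mathlib

open Filter Topology
open scoped Kronecker Matrix ENNReal

section Codes

variable {F : Type*} [Field F] {ι : Type*} [Fintype ι]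

/-- The dual code `C^⊥` for the standard bilinear form. -/
def dualCode (C : Submodule F (ι → F)) : Submodule F (ι → F) where
  carrier := {x | ∀ y ∈ C, x ⬝ᵥ y = 0}
  zero_mem' := fun y _ => zero_dotProduct y
  add_mem' := fun {a b} ha hb y hy => by rw [add_dotProduct, ha y hy, hb y hy, add_zero]
  smul_mem' := fun c x hx y hy => by rw [smul_dotProduct, hx y hy, smul_zero]

/-- The code with parity-check matrix `H`, i.e. `ker H`. -/
def kerCode {κ : Type*} (H : Matrix κ ι F) : Submodule F (ι → F) :=
  LinearMap.ker H.mulVecLin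

/-- `H` is a parity-check matrix of `C` of full (row) rank. -/
def IsFullRankParityCheck {r : ℕ} (H : Matrix (Fin r) ι F) (C : Submodule F (ι → F)) : Prop :=
  kerCode H = C ∧ H.rank = r

variable [DecidableEq F]

/-- The checks `H` witness that the code `C` is locally testable with locality at most `w` and
soundness at least `ρ`: `H` is a parity-check matrix of `C`, each of its rows and columns has at
most `w` nonzero entries, and every syndrome `s` has a preimage `e` with `|s| / m ≥ ρ |e| / n`. -/
def IsTester {κ : Type*} [Fintype κ] (H : Matrix κ ι F) (C : Submodule F (ι → F))
    (w : ℕ) (ρ : ℝ) : Prop :=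
  kerCode H = C ∧
  (∀ i : κ, hammingNorm (fun j : ι => H i j) ≤ w) ∧
  (∀ j : ι, hammingNorm (fun i : κ => H i j) ≤ w) ∧
  ∀ s ∈ LinearMap.range H.mulVecLin, ∃ e : ι → F, H *ᵥ e = s ∧
    ρ * ((hammingNorm e : ℝ) / (Fintype.card ι : ℝ)) ≤
      (hammingNorm s : ℝ) / (Fintype.card κ : ℝ)

/-- The classical code `C` is locally testable of locality `≤ w` and soundness `≥ ρ`. -/
def IsLTC (C : Submodule F (ι → F)) (w : ℕ) (ρ : ℝ) : Prop :=
  ∃ (m : ℕ) (H : Matrix (Fin m) ι F), IsTester H C w ρ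

end Codes

/-- A quantum CSS code over `F` with physical qudits indexed by `ι`. -/
structure CSSCode (F : Type*) [Field F] (ι : Type*) [Fintype ι] where
  QX : Submodule F (ι → F)
  QZ : Submodule F (ι → F)
  css : dualCode QX ≤ QZ

namespace CSSCode

variable {F : Type*} [Field F] {ι : Type*} [Fintype ι]

instance instFiniteCSSCode [Finite F] : Finite (CSSCode F ι) := by
  refine Finite.of_injective
    (fun Q : CSSCode F ι => (((Q.QX : Set (ι → F)), (Q.QZ : Set (ι → F))) :
      Set (ι → F) × Set (ι → F))) ?_
  rintro ⟨a, b, h⟩ ⟨a', b', h'⟩ hab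
  simp only [Prod.mk.injEq, SetLike.coe_set_eq] at hab
  obtain ⟨rfl, rfl⟩ := hab
  rfl

/-- `dim Q_Z - dim Q_X^⊥`; the subtraction never truncates because `Q_X^⊥ ≤ Q_Z`. -/
noncomputable def dim (Q : CSSCode F ι) : ℕ :=
  Module.finrank F Q.QZ - Module.finrank F (dualCode Q.QX)

noncomputable def rate (Q : CSSCode F ι) : ℝ := (Q.dim : ℝ) / (Fintype.card ι : ℝ)

variable [DecidableEq F]

/-- The minimum Hamming weight over `(Q_X \ Q_Z^⊥) ∪ (Q_Z \ Q_X^⊥)`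
(`⊤` if this set is empty, that is, if `Q` has dimension `0`). -/
noncomputable def distance (Q : CSSCode F ι) : ℕ∞ :=
  ⨅ c ∈ ((Q.QX : Set (ι → F)) \ (dualCode Q.QZ : Set (ι → F))) ∪
    ((Q.QZ : Set (ι → F)) \ (dualCode Q.QX : Set (ι → F))), (hammingNorm c : ℕ∞)

/-- `Q` is an `[[N, K, D]]` code: length `N`, dimension `K`, and distance at least `D`. -/
def HasParams (Q : CSSCode F ι) (N : ℕ) (K D : ℝ) : Prop :=
  Fintype.card ι = N ∧ (Q.dim : ℝ) = K ∧ ENNReal.ofReal D ≤ (Q.distance : ℝ≥0∞)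

/-- `Q` is locally testable of locality `≤ w` and soundness `≥ ρ`. -/
def IsLTC (Q : CSSCode F ι) (w : ℕ) (ρ : ℝ) : Prop :=
  _root_.IsLTC Q.QX w ρ ∧ _root_.IsLTC Q.QZ w ρ

end CSSCode

/-- A single-sector chain complex on the based space `F^ι`; `bd` is the matrix of the boundary map
in the standard basis. -/
structure SSComplex (F : Type*) [Field F] (ι : Type*) [Fintype ι] where
  bd : Matrix ι ι F
  bd_sq : bd * bd = 0

namespace SSComplex

variable {F : Type*} [Field F] {ι κ : Type*} [Fintype ι] [Fintype κ]

theorem dual_kerCode_le {r m : ℕ} (A : Matrix (Fin r) ι F) (B : Matrix (Fin m) ι F)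
    (h : dualCode (kerCode A) ≤ kerCode B) : B * Aᵀ = 0 := by
  ext i j
  have hA : (fun k => A j k) ∈ dualCode (kerCode A) := by
    intro y hy
    have := congrFun (show A *ᵥ y = 0 from hy) j
    simpa [Matrix.mulVec] using this
  have hB : B *ᵥ (fun k => A j k) = 0 := h hA
  simpa [Matrix.mul_apply, Matrix.mulVec, dotProduct] using congrFun hB i

/-- The quantum code associated to a complex: `Q_X = ker ∂ᵀ` and `Q_Z = ker ∂`. -/
def toCSS [DecidableEq ι] (A : SSComplex F ι) : CSSCode F ι where
  QX := kerCode A.bdᵀ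
  QZ := kerCode A.bd
  css := by
    intro x hx
    -- `x ⊥ ker ∂ᵀ ⊇ im ∂ᵀ`, hence `∂ x = 0`
    have hsq : A.bdᵀ * A.bdᵀ = 0 := by rw [← Matrix.transpose_mul, A.bd_sq, Matrix.transpose_zero]
    have key : ∀ v : ι → F, v ⬝ᵥ (A.bd *ᵥ x) = 0 := by
      intro v
      have hv : A.bdᵀ *ᵥ v ∈ kerCode A.bdᵀ := by
        change A.bdᵀ *ᵥ (A.bdᵀ *ᵥ v) = 0
        rw [Matrix.mulVec_mulVec, hsq, Matrix.zero_mulVec]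
      have h0 := hx _ hv
      rw [Matrix.mulVec_transpose] at h0
      rw [Matrix.dotProduct_mulVec, dotProduct_comm]
      exact h0
    change A.bd *ᵥ x = 0
    ext i
    simpa using key (Pi.single i 1)

/-- The single-sector complex with boundary `H_Xᵀ H_Z` obtained from a CSS code `Q` and full-rank
parity-check matrices `H_X`, `H_Z` with the same number of rows. -/
def ofCSS (Q : CSSCode F ι) {r : ℕ} (HX HZ : Matrix (Fin r) ι F)
    (hX : IsFullRankParityCheck HX Q.QX) (hZ : IsFullRankParityCheck HZ Q.QZ) :
    SSComplex F ι where
  bd := HXᵀ * HZ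
  bd_sq := by
    have h0 : HZ * HXᵀ = 0 := by
      apply dual_kerCode_le
      rw [hX.1, hZ.1]
      exact Q.css
    rw [Matrix.mul_assoc, ← Matrix.mul_assoc HZ, h0, Matrix.zero_mul, Matrix.mul_zero]

/-- The homological product, on `F^ι ⊗ F^κ = F^(ι × κ)`, with boundary `∂_A ⊗ I + I ⊗ ∂_B`. -/
def prod [CharP F 2] [DecidableEq ι] [DecidableEq κ] (A : SSComplex F ι) (B : SSComplex F κ) :
    SSComplex F (ι × κ) where
  bd := A.bd ⊗ₖ (1 : Matrix κ κ F) + (1 : Matrix ι ι F) ⊗ₖ B.bd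
  bd_sq := by
    rw [Matrix.add_mul, Matrix.mul_add, Matrix.mul_add, ← Matrix.mul_kronecker_mul,
      ← Matrix.mul_kronecker_mul, ← Matrix.mul_kronecker_mul, ← Matrix.mul_kronecker_mul,
      A.bd_sq, B.bd_sq]
    simp only [Matrix.mul_one, Matrix.one_mul, Matrix.zero_kronecker, Matrix.kronecker_zero,
      zero_add, add_zero]
    ext i j
    exact CharTwo.add_self_eq_zero _

end SSComplex

/-- The CSS codes of length `n` and rate `R` over `F` with `dim Q_X = dim Q_Z`. -/
def balancedCSSCodes (F : Type*) [Field F] (n : ℕ) (R : ℝ) : Set (CSSCode F (Fin n)) :=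
  {Q | Module.finrank F Q.QX = Module.finrank F Q.QZ ∧ Q.rate = R}

/-- The probability of `P` for a uniformly random element of the (nonempty) set `S`. -/
noncomputable def uniformProb {α : Type*} [Finite α] (S : Set α) (P : α → Prop) : ℝ :=
  (({x ∈ S | P x}.ncard : ℕ) : ℝ) / ((S.ncard : ℕ) : ℝ)

/-! ### Dual codes and kernel codes -/

section DualCode

variable {F : Type*} [Field F] {ι : Type*} [Fintype ι]

/-! Read chains of the product as n × n matrices M, so that the boundary is M ↦ ∂₁M + M∂₂ᵀ. The
deterministic core is a strong product expansion, `IsPairGood`, at scale m = ⌊αn⌋, for the pair of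
Q_Z's and for the pair of Q_X's (where transposes replace ∂ᵢ).

A cycle s of weight at most m(m+1) has at most m rows S and m columns T of weight over m. A
generalized inverse of ∂₁ splits s into a matrix with columns in ker ∂₁ plus one with rows in ker
∂₂, so expansion confines s to the rows S and the columns T. Goodness also makes each ∂ᵢ injective
on vectors of weight at most m, and then s bounds some M supported on S × T, whence |M| ≤ |S||T| ≤
|s| (`exists_filling_of_support`, `IsPairGood.exists_filling`). This yields the distance, as light
cycles are boundaries, and the soundness: light syndromes have preimages that are no heavier, while
heavy ones have weight of order n², so any preimage will do. The dimension is a Künneth formula, by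
contracting homotopies (`IsHomotopy.prod`).

A pair (C₁, C₂) that is not good yields a matrix X of some rank r ≥ 1 with all rows and columns of
weight at most m. Checks of C₁ vanishing on S send X to vectors that agree off T with words of C₂.
For t about δr/4, either these images span more than t dimensions, and C₂ contains t + 1 of them up
to sparse errors; or r − t independent combinations of columns of X lie in C₁ up to sparse errors
(`exists_meets_of_not_isPairGood`). As X is encoded by r columns, r rows and r positions, a union
bound applies: a random code contains s given independent vectors with probability at most q^(−ds),
d ≥ εn/2 (`isSpread_of_linearEquiv`), whereas there are only q^(ηn) sparse vectors, with η small.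
Failure has probability O(n 2^(−cn)). -/

theorem dualCode_eq_orthogonal [DecidableEq ι] (C : Submodule F (ι → F)) :
    dualCode C = (Matrix.toBilin' (1 : Matrix ι ι F)).orthogonal C := by
  ext x
  simp only [LinearMap.BilinForm.mem_orthogonal_iff, Matrix.toBilin'_apply', Matrix.one_mulVec]
  exact forall₂_congr fun y _ => by rw [dotProduct_comm]

theorem nondegenerate_toBilin'_one [DecidableEq ι] :
    (Matrix.toBilin' (1 : Matrix ι ι F)).Nondegenerate := by
  apply LinearMap.BilinForm.nondegenerate_toBilin'_of_det_ne_zero'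
  simp

theorem isRefl_toBilin'_one [DecidableEq ι] :
    (Matrix.toBilin' (1 : Matrix ι ι F)).IsRefl := by
  intro x y h
  simpa [Matrix.toBilin'_apply', dotProduct_comm] using h

theorem finrank_dualCode (C : Submodule F (ι → F)) :
    Module.finrank F (dualCode C) = Fintype.card ι - Module.finrank F C := by
  classical
  rw [dualCode_eq_orthogonal, LinearMap.BilinForm.finrank_orthogonal nondegenerate_toBilin'_one,
    Module.finrank_fintype_fun_eq_card]

theorem dualCode_dualCode (C : Submodule F (ι → F)) : dualCode (dualCode C) = C := by
  classical
  rw [dualCode_eq_orthogonal, dualCode_eq_orthogonal,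
    LinearMap.BilinForm.orthogonal_orthogonal nondegenerate_toBilin'_one isRefl_toBilin'_one]

theorem dualCode_anti {C D : Submodule F (ι → F)} (h : C ≤ D) : dualCode D ≤ dualCode C :=
  fun _ hx y hy => hx y (h hy)

theorem mem_kerCode {κ : Type*} {H : Matrix κ ι F} {x : ι → F} :
    x ∈ kerCode H ↔ H *ᵥ x = 0 := Iff.rfl

/-- By double duality. With `H` equal to ∂ or ∂ᵀ it identifies the trivial logical operators with
the boundaries. -/
theorem dualCode_kerCode {κ : Type*} [Fintype κ] (H : Matrix κ ι F) :
    dualCode (kerCode H) = LinearMap.range Hᵀ.mulVecLin := by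
  have h : kerCode H = dualCode (LinearMap.range Hᵀ.mulVecLin) := by
    ext x
    rw [mem_kerCode]
    constructor
    · rintro hx _ ⟨y, rfl⟩
      rw [Matrix.mulVecLin_apply, Matrix.dotProduct_mulVec, Matrix.vecMul_transpose, hx,
        zero_dotProduct]
    · intro hx
      classical
      ext i
      have := hx _ ⟨Pi.single i 1, rfl⟩
      rwa [Matrix.mulVecLin_apply, Matrix.dotProduct_mulVec, Matrix.vecMul_transpose,
        dotProduct_single_one] at this
  rw [h, dualCode_dualCode]

/-- If the kernel of `A` lies in the kernel of `B`, then `B` factors through `A`. -/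
theorem Matrix.exists_mul_eq_of_kerCode_le {κ μ : Type*} [Fintype κ]
    {A : Matrix κ ι F} {B : Matrix μ ι F} (h : kerCode A ≤ kerCode B) :
    ∃ P : Matrix μ κ F, P * A = B := by
  have key : ∀ i, ∃ y : κ → F, Aᵀ *ᵥ y = B i := by
    intro i
    have : B i ∈ dualCode (kerCode A) := fun x hx => congrFun (mem_kerCode.1 (h hx)) i
    rw [dualCode_kerCode] at this
    exact this
  choose y hy using key
  refine ⟨Matrix.of y, ?_⟩
  ext i j
  rw [← hy i, Matrix.mulVec_transpose]
  rfl

end DualCode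

/-! ### Ranks of matrices -/

section Rank

namespace Matrix

variable {F : Type*} [Field F]

theorem exists_isUnit_mul_mul_eq_diagonal {ι : Type*} [Fintype ι] [DecidableEq ι]
    (M : Matrix ι ι F) :
    ∃ (V U : Matrix ι ι F) (D : ι → F), IsUnit V.det ∧ IsUnit U.det ∧ V * M * U = diagonal D := by
  obtain ⟨V, U, e, hV, hU, h⟩ := M.exists_rank_normal_form
  refine ⟨V, U, fun i => Sum.elim (fun _ => 1) (fun _ => 0) (e i),
    (isUnit_iff_isUnit_det _).1 hV, (isUnit_iff_isUnit_det _).1 hU, ?_⟩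
  rw [h, ← diagonal_one, ← diagonal_zero, fromBlocks_diagonal, submatrix_diagonal_equiv]
  rfl

theorem rank_mul_mul_of_isUnit_det {ι : Type*} [Fintype ι] [DecidableEq ι]
    (M : Matrix ι ι F) {V U : Matrix ι ι F} (hV : IsUnit V.det) (hU : IsUnit U.det) :
    (V * M * U).rank = M.rank := by
  rw [rank_mul_eq_left_of_isUnit_det _ _ hU, rank_mul_eq_right_of_isUnit_det _ _ hV]

/-- Both factors can be made diagonal by invertible matrices; a product of two diagonal entries is
nonzero exactly when both are. -/
theorem rank_kronecker {ι κ : Type*} [Fintype ι] [Fintype κ] [DecidableEq ι] [DecidableEq κ]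
    (A : Matrix ι ι F) (B : Matrix κ κ F) : (A ⊗ₖ B).rank = A.rank * B.rank := by
  classical
  obtain ⟨V, U, D, hV, hU, h⟩ := A.exists_isUnit_mul_mul_eq_diagonal
  obtain ⟨V', U', D', hV', hU', h'⟩ := B.exists_isUnit_mul_mul_eq_diagonal
  have hVV : IsUnit (V ⊗ₖ V').det := by
    rw [det_kronecker]
    exact (hV.pow _).mul (hV'.pow _)
  have hUU : IsUnit (U ⊗ₖ U').det := by
    rw [det_kronecker]
    exact (hU.pow _).mul (hU'.pow _)
  rw [← rank_mul_mul_of_isUnit_det _ hVV hUU, ← mul_kronecker_mul, ← mul_kronecker_mul, h, h',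
    diagonal_kronecker_diagonal, rank_diagonal, ← rank_mul_mul_of_isUnit_det A hV hU, h,
    ← rank_mul_mul_of_isUnit_det B hV' hU', h', rank_diagonal, rank_diagonal, ← Fintype.card_prod]
  refine Fintype.card_congr ⟨fun x => (⟨x.1.1, left_ne_zero_of_mul x.2⟩,
    ⟨x.1.2, right_ne_zero_of_mul x.2⟩), fun x => ⟨(x.1, x.2), mul_ne_zero x.1.2 x.2.2⟩,
    fun _ => rfl, fun _ => rfl⟩

theorem exists_mul_eq_one_of_rank_eq {ι : Type*} [Fintype ι] {r : ℕ} {H : Matrix (Fin r) ι F}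
    (h : H.rank = r) : ∃ R : Matrix ι (Fin r) F, H * R = 1 := by
  rw [← mulVec_surjective_iff_exists_right_inverse]
  have : LinearMap.range H.mulVecLin = ⊤ := by
    apply Submodule.eq_top_of_finrank_eq
    rw [Module.finrank_fin_fun]
    exact h
  exact LinearMap.range_eq_top.1 this

end Matrix

end Rank

/-! ### Contracting homotopies and the Künneth formula -/

section Contraction

variable {F : Type*} [Field F] {ι κ : Type*} [Fintype ι] [Fintype κ] [DecidableEq ι] [DecidableEq κ]

/-- `h` is a contracting homotopy of the square-zero matrix `d` onto the harmonic space
`im π`. -/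
structure IsHomotopy (d h π : Matrix ι ι F) : Prop where
  homotopy : d * h + h * d + π = 1
  mul_left : π * d = 0
  mul_right : d * π = 0
  idem : π * π = π

namespace IsHomotopy

variable {d h π : Matrix ι ι F}

/-- Makes `h` a generalized inverse of `d`, which is what splits a cycle of the product. -/
theorem regular (H : IsHomotopy d h π) (hd : d * d = 0) : d * h * d = d := by
  have := congrArg (· * d) H.homotopy
  simpa [Matrix.add_mul, Matrix.mul_assoc, hd, H.mul_left] using this

/-- The homotopy identity gives ker d = im d ⊕ im π, so `π.rank` is the dimension of the homology.
-/
theorem finrank_kerCode (H : IsHomotopy d h π) (hd : d * d = 0) :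
    Module.finrank F (kerCode d) = d.rank + π.rank := by
  have hsup : kerCode d = LinearMap.range d.mulVecLin ⊔ LinearMap.range π.mulVecLin := by
    apply le_antisymm
    · intro x hx
      rw [mem_kerCode] at hx
      have hx' : x = d *ᵥ (h *ᵥ x) + π *ᵥ x := by
        have := congrArg (· *ᵥ x) H.homotopy
        simp only [Matrix.add_mulVec, Matrix.one_mulVec, ← Matrix.mulVec_mulVec, hx,
          Matrix.mulVec_zero, add_zero] at this
        exact this.symm
      rw [hx']
      exact Submodule.add_mem_sup ⟨_, rfl⟩ ⟨_, rfl⟩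
    · refine sup_le ?_ ?_
      · rintro _ ⟨y, rfl⟩
        simp [mem_kerCode, hd]
      · rintro _ ⟨y, rfl⟩
        simp [mem_kerCode, H.mul_right]
  have hinf : LinearMap.range d.mulVecLin ⊓ LinearMap.range π.mulVecLin = ⊥ := by
    rw [eq_bot_iff]
    rintro _ ⟨⟨y, rfl⟩, ⟨z, hz⟩⟩
    have h1 : π *ᵥ (d *ᵥ y) = 0 := by simp [H.mul_left]
    simp only [Matrix.mulVecLin_apply] at hz
    rw [← hz, Matrix.mulVec_mulVec, H.idem, hz] at h1
    simpa using h1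
  have := Submodule.finrank_sup_add_finrank_inf_eq (LinearMap.range d.mulVecLin)
    (LinearMap.range π.mulVecLin)
  rw [hinf, finrank_bot, add_zero, ← hsup] at this
  exact this

/-- First contract the left factor, then contract the right factor over the harmonic part of the
left. The cross term `h ⊗ₖ d'` occurs twice and cancels in characteristic 2. -/
theorem prod [CharP F 2] {d' h' π' : Matrix κ κ F} (H : IsHomotopy d h π)
    (H' : IsHomotopy d' h' π') :
    IsHomotopy (d ⊗ₖ (1 : Matrix κ κ F) + (1 : Matrix ι ι F) ⊗ₖ d')
      (h ⊗ₖ (1 : Matrix κ κ F) + π ⊗ₖ h') (π ⊗ₖ π') where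
  homotopy := by
    have h2 : h ⊗ₖ d' + h ⊗ₖ d' = 0 := by
      ext i j
      exact CharTwo.add_self_eq_zero _
    have e1 : (d * h + h * d) ⊗ₖ (1 : Matrix κ κ F) + π ⊗ₖ (1 : Matrix κ κ F) = 1 := by
      rw [← Matrix.add_kronecker, H.homotopy, Matrix.one_kronecker_one]
    have e2 : π ⊗ₖ (d' * h' + h' * d') + π ⊗ₖ π' = π ⊗ₖ (1 : Matrix κ κ F) := by
      rw [← Matrix.kronecker_add, H'.homotopy]
    simp only [Matrix.add_mul, Matrix.mul_add, ← Matrix.mul_kronecker_mul, Matrix.one_mul,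
      Matrix.mul_one, H.mul_left, H.mul_right, Matrix.zero_kronecker, add_zero, zero_add]
    rw [← e1, ← e2, Matrix.add_kronecker, Matrix.kronecker_add]
    rw [← sub_eq_zero, ← h2]
    abel
  mul_left := by
    simp [Matrix.mul_add, ← Matrix.mul_kronecker_mul, H.mul_left, H'.mul_left]
  mul_right := by
    simp [Matrix.add_mul, ← Matrix.mul_kronecker_mul, H.mul_right, H'.mul_right]
  idem := by rw [← Matrix.mul_kronecker_mul, H.idem, H'.idem]

theorem transpose (H : IsHomotopy d h π) : IsHomotopy dᵀ hᵀ πᵀ where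
  homotopy := by
    rw [← Matrix.transpose_mul, ← Matrix.transpose_mul, ← Matrix.transpose_add,
      ← Matrix.transpose_add, add_comm (h * d), H.homotopy, Matrix.transpose_one]
  mul_left := by rw [← Matrix.transpose_mul, H.mul_right, Matrix.transpose_zero]
  mul_right := by rw [← Matrix.transpose_mul, H.mul_left, Matrix.transpose_zero]
  idem := by rw [← Matrix.transpose_mul, H.idem]

end IsHomotopy

/-- For a right inverse `R` of `B` and a left inverse `L` of `Aᵀ` with `L * R = 0`, the choice `h =
R * L` makes `Aᵀ * L` and `R * B` orthogonal idempotents, and π is the complementary one. -/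
theorem exists_isHomotopy {r : ℕ} {A B : Matrix (Fin r) ι F} (hA : A.rank = r) (hB : B.rank = r)
    (h0 : B * Aᵀ = 0) : ∃ h π, IsHomotopy (Aᵀ * B) h π := by
  obtain ⟨R, hR⟩ := Matrix.exists_mul_eq_one_of_rank_eq hB
  obtain ⟨L₀, hL₀⟩ := Matrix.exists_mul_eq_one_of_rank_eq hA
  have hL₁ : L₀ᵀ * Aᵀ = 1 := by rw [← Matrix.transpose_mul, hL₀, Matrix.transpose_one]
  obtain ⟨L, hL, hLR⟩ : ∃ L : Matrix (Fin r) ι F, L * Aᵀ = 1 ∧ L * R = 0 := by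
    -- The correction kills `R` and does not disturb `L * Aᵀ = 1`, since `B * Aᵀ = 0`.
    refine ⟨L₀ᵀ - L₀ᵀ * R * B, ?_, ?_⟩
    · rw [Matrix.sub_mul, hL₁, Matrix.mul_assoc _ B, h0, Matrix.mul_zero, sub_zero]
    · rw [Matrix.sub_mul, Matrix.mul_assoc _ B, hR, Matrix.mul_one, sub_self]
  have r2 : ∀ (X : Matrix (Fin r) ι F), L * (Aᵀ * X) = X := fun X => by
    rw [← Matrix.mul_assoc, hL, Matrix.one_mul]
  have r3 : ∀ (X : Matrix (Fin r) ι F), B * (Aᵀ * X) = 0 := fun X => by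
    rw [← Matrix.mul_assoc, h0, Matrix.zero_mul]
  have r4 : ∀ (X : Matrix (Fin r) ι F), L * (R * X) = 0 := fun X => by
    rw [← Matrix.mul_assoc, hLR, Matrix.zero_mul]
  have r1 : ∀ (X : Matrix (Fin r) ι F), B * (R * X) = X := fun X => by
    rw [← Matrix.mul_assoc, hR, Matrix.one_mul]
  refine ⟨R * L, 1 - (Aᵀ * L + R * B), ?_, ?_, ?_, ?_⟩
  · simp only [Matrix.mul_assoc, r1, r2]
    abel
  · simp only [Matrix.mul_assoc, Matrix.sub_mul, Matrix.add_mul, r2, r3, Matrix.one_mul,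
      Matrix.mul_zero]
    abel
  · simp only [Matrix.mul_assoc, Matrix.mul_sub, Matrix.mul_add, r1, r3, Matrix.mul_one,
      Matrix.mul_zero]
    abel
  · simp only [Matrix.mul_assoc, Matrix.mul_sub, Matrix.mul_add, Matrix.sub_mul, Matrix.add_mul,
      r1, r2, r3, r4, Matrix.mul_one, Matrix.one_mul, Matrix.mul_zero]
    abel

end Contraction

/-! ### Filling a cycle supported on few rows and columns: the algebra -/

section Filling

/-- In a ring where `x + x = 0`, an element `s` with `E s = s G` that is supported on the rows
`D` and the columns `D'` is of the form `E M + M G` with `M` supported on `D × D'`, provided that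
`E` and `G` have one-sided inverses on `D` and `D'`. -/
theorem exists_filling_of_support {R : Type*} [Ring R] (h2 : ∀ x : R, x + x = 0) {E G P Q D D' s : R}
    (hG : G * G = 0) (hPE : P * E * D = D) (hDP : D * P = P) (hGQ : D' * G * Q = D')
    (hQD : Q * D' = Q) (hs : E * s = s * G) (hsupp : D * (s * (1 + D')) = s * (1 + D'))
    (hD' : D' * D' = D') :
    ∃ M, D * M * D' = M ∧ s = E * M + M * G := by
  -- `sS` is the part of `s` off the columns `D'`, hence in the rows `D`; `w` lies in the rows `D`
  -- and the columns `D'`. Adding `w` to both parts keeps the sum `s` and yields `E a = 0`, `b G =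
  -- 0` and `E b = a G`.
  set sS := s * (1 + D') with hsS
  set w := sS * G * Q with hw
  set a := s * D' + w with ha
  set b := sS + w with hb
  have hsplit : s * D' + sS = s := by
    rw [hsS, mul_add, mul_one, add_comm, add_assoc, h2, add_zero]
  have hab : a + b = s := by
    rw [ha, hb, add_comm sS w, add_assoc, ← add_assoc w, h2, zero_add, hsplit]
  have haD : a * D' = a := by
    rw [ha, hw, add_mul, mul_assoc s, hD', mul_assoc _ Q, hQD]
  have hbD : D * b = b := by
    rw [hb, hw, mul_add, hsupp, ← mul_assoc, ← mul_assoc, hsupp]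
  have hEa : E * a = 0 := by
    have h1 : s * D' = s * D' * G * Q := by
      rw [mul_assoc s, mul_assoc s, hGQ]
    have h3 : a = s * G * Q := by
      rw [ha, hw, h1, ← add_mul, ← add_mul, hsplit]
    rw [h3, ← mul_assoc, ← mul_assoc, hs, mul_assoc s, hG, mul_zero, zero_mul]
  have hEb : E * b = a * G + b * G := by
    calc E * b = E * (a + b) := by rw [mul_add E a b, hEa, zero_add]
      _ = a * G + b * G := by rw [← add_mul, hab, hs]
  have hbG : b * G = 0 := by
    have h1 : E * (b * G) = 0 := by
      rw [← mul_assoc, hEb, ← add_mul, hab, mul_assoc, hG, mul_zero]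
    have h3 : b * G = D * (b * G) := by rw [← mul_assoc, hbD]
    rw [h3, ← hPE, mul_assoc, ← h3, mul_assoc, h1, mul_zero]
  rw [hbG, add_zero] at hEb
  have hb1 : b = P * a * G := by
    calc b = D * b := hbD.symm
      _ = P * E * D * b := by rw [hPE]
      _ = P * (E * b) := by rw [mul_assoc _ D, hbD, mul_assoc]
      _ = P * a * G := by rw [hEb, mul_assoc]
  have ha1 : a = E * b * Q := by
    calc a = a * D' := haD.symm
      _ = a * (D' * G * Q) := by rw [hGQ]
      _ = a * D' * G * Q := by simp only [mul_assoc]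
      _ = E * b * Q := by rw [haD, hEb]
  have hbQ : b * Q = P * a := by
    calc b * Q = P * (a * D') * G * Q := by rw [haD, ← hb1]
      _ = P * a * (D' * G * Q) := by simp only [mul_assoc]
      _ = P * a := by rw [hGQ, mul_assoc, haD]
  -- The equality `P a = b Q` gives `E M = a` and `M G = b`.
  refine ⟨P * a, ?_, ?_⟩
  · rw [← mul_assoc, hDP, mul_assoc, haD]
  · rw [← hb1, ← hbQ, ← mul_assoc, ← ha1, hab]

end Filling

/-! ### Product expansion of a pair of codes -/

section PairGood

variable {F : Type*} [Field F] [DecidableEq F] {ι : Type*} [Fintype ι]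

/-- Product expansion in a strong form: if `A + B`, with the columns of `A` in `C₁` and the rows
of `B` in `C₂`, has at most `m` rows and at most `m` columns of weight more than `m`, then it is
supported on these rows and columns. -/
def IsPairGood (m : ℕ) (C₁ C₂ : Submodule F (ι → F)) : Prop :=
  ∀ A B : Matrix ι ι F, (∀ j, Aᵀ j ∈ C₁) → (∀ i, B i ∈ C₂) →
    ∀ S T : Finset ι, S.card ≤ m → T.card ≤ m →
      (∀ i ∉ S, hammingNorm ((A + B) i) ≤ m) → (∀ j ∉ T, hammingNorm ((A + B)ᵀ j) ≤ m) →
      ∀ i ∉ S, ∀ j ∉ T, (A + B) i j = 0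

theorem IsPairGood.symm {m : ℕ} {C₁ C₂ : Submodule F (ι → F)} (h : IsPairGood m C₁ C₂) :
    IsPairGood m C₂ C₁ := by
  intro A B hA hB S T hS hT hrow hcol i hi j hj
  have := h Bᵀ Aᵀ hB hA T S hT hS
  rw [← Matrix.transpose_add, add_comm B A] at this
  exact this hcol hrow j hj i hi

/-- Place the word in a single column: every row then has weight at most 1 ≤ m, so expansion applies
with no exceptional rows or columns. -/
theorem IsPairGood.eq_zero {m : ℕ} (hm : 1 ≤ m) {C₁ C₂ : Submodule F (ι → F)}
    (h : IsPairGood m C₁ C₂) {x : ι → F} (hx : x ∈ C₁) (hxm : hammingNorm x ≤ m) : x = 0 := by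
  classical
  ext i
  have key := h (Matrix.of fun k l => if l = i then x k else 0) 0 ?_ (fun _ => C₂.zero_mem) ∅ ∅
    (by simp) (by simp) ?_ ?_ i (by simp) i (by simp)
  · simpa using key
  · intro j
    by_cases hj : j = i
    · convert hx using 1
      ext k
      simp [hj]
    · convert C₁.zero_mem using 1
      ext k
      simp [hj]
  · intro k _
    refine le_trans ?_ hm
    refine (Finset.card_le_card (t := {i}) ?_).trans (by simp)
    intro l
    simp only [add_zero, Matrix.of_apply, Finset.mem_filter, Finset.mem_univ, true_and,
      Finset.mem_singleton]
    intro hl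
    by_contra hne
    simp [hne] at hl
  · intro j _
    by_cases hj : j = i
    · convert hxm using 2
      ext k
      simp [hj]
    · convert Nat.zero_le m
      rw [hammingNorm_eq_zero]
      ext k
      simp [hj]

end PairGood

/-! ### Weights of matrices and heavy rows -/

section Weight

variable {F : Type*} [Field F] [DecidableEq F] {ι : Type*} [Fintype ι]

/-- The number of nonzero entries of a matrix. -/
def Matrix.weight (X : Matrix ι ι F) : ℕ := hammingNorm fun p : ι × ι => X p.1 p.2

theorem Matrix.weight_eq_sum (X : Matrix ι ι F) : X.weight = ∑ i, hammingNorm (X i) := by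
  simp only [Matrix.weight, hammingNorm, Finset.card_filter, Fintype.sum_prod_type]

theorem Matrix.weight_transpose (X : Matrix ι ι F) : Xᵀ.weight = X.weight := by
  simp only [Matrix.weight, hammingNorm, Finset.card_filter, Fintype.sum_prod_type]
  rw [Finset.sum_comm]
  rfl

/-- The set of rows of weight more than `m`. -/
def Matrix.heavyRows (X : Matrix ι ι F) (m : ℕ) : Finset ι :=
  Finset.univ.filter fun i => m < hammingNorm (X i)

theorem Matrix.card_heavyRows_mul_le (X : Matrix ι ι F) (m : ℕ) :
    (X.heavyRows m).card * (m + 1) ≤ X.weight := by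
  rw [X.weight_eq_sum]
  calc (X.heavyRows m).card * (m + 1) = ∑ i ∈ X.heavyRows m, (m + 1) := by simp
    _ ≤ ∑ i ∈ X.heavyRows m, hammingNorm (X i) :=
      Finset.sum_le_sum fun i hi => (Finset.mem_filter.1 hi).2
    _ ≤ _ := Finset.sum_le_sum_of_subset (Finset.subset_univ _)

theorem Matrix.weight_le_of_support {X : Matrix ι ι F} {S T : Finset ι}
    (h : ∀ i j, X i j ≠ 0 → i ∈ S ∧ j ∈ T) : X.weight ≤ S.card * T.card := by
  have hsub : (Finset.univ.filter fun p : ι × ι => X p.1 p.2 ≠ 0) ⊆ S ×ˢ T := fun p hp =>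
    Finset.mem_product.2 (h _ _ (Finset.mem_filter.1 hp).2)
  exact (Finset.card_le_card hsub).trans_eq (Finset.card_product S T)

end Weight

/-! ### Filling light cycles -/

section Filling

variable {F : Type*} [Field F] [DecidableEq F] {ι : Type*} [Fintype ι] [DecidableEq ι]

/-- The coordinate projection onto `S`. -/
def Matrix.coordProj (F : Type*) [Field F] (S : Finset ι) : Matrix ι ι F :=
  Matrix.diagonal fun i => if i ∈ S then 1 else 0

omit [DecidableEq F] in
theorem Matrix.coordProj_mul_self (S : Finset ι) :
    coordProj F S * coordProj F S = coordProj F S := by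
  simp [coordProj]

/-- A vector supported on `S` has weight at most `S.card`, so `E` is injective on such vectors and
the projection factors through `E * coordProj F S`. -/
theorem Matrix.exists_left_inverse_coordProj {E : Matrix ι ι F} {S : Finset ι}
    (h : ∀ x ∈ kerCode E, hammingNorm x ≤ S.card → x = 0) :
    ∃ P, P * E * coordProj F S = coordProj F S ∧ coordProj F S * P = P := by
  obtain ⟨P, hP⟩ : ∃ P, P * (E * coordProj F S) = coordProj F S := by
    apply exists_mul_eq_of_kerCode_le
    intro x hx
    rw [mem_kerCode, ← mulVec_mulVec] at hx
    refine h _ hx (Finset.card_le_card fun i hi => ?_)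
    by_contra hS
    simp [coordProj, mulVec_diagonal, hS] at hi
  refine ⟨coordProj F S * P, ?_, ?_⟩
  · rw [mul_assoc, mul_assoc, hP, coordProj_mul_self]
  · rw [← mul_assoc, coordProj_mul_self]

/-- The threshold m(m+1) ensures at most `m` heavy rows and `m` heavy columns. The filling lives on
their product, and each heavy row pays for at least m + 1 ≥ |T| entries of `s`. -/
theorem IsPairGood.exists_filling [CharP F 2] {m : ℕ} (hm : 1 ≤ m) {E₁ E₂ g : Matrix ι ι F}
    (hg : E₁ * g * E₁ = E₁) (hE₂ : E₂ * E₂ = 0)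
    (good : IsPairGood m (kerCode E₁) (kerCode E₂)) {s : Matrix ι ι F}
    (hs : E₁ * s = s * E₂ᵀ) (hw : s.weight ≤ m * (m + 1)) :
    ∃ M : Matrix ι ι F, s = E₁ * M + M * E₂ᵀ ∧ M.weight ≤ s.weight := by
  set S := s.heavyRows m with hS
  set T := sᵀ.heavyRows m with hT
  have hSw : S.card * (m + 1) ≤ s.weight := s.card_heavyRows_mul_le m
  have hTw : T.card * (m + 1) ≤ s.weight := s.weight_transpose ▸ sᵀ.card_heavyRows_mul_le m
  have hSm : S.card ≤ m := Nat.le_of_mul_le_mul_right (hSw.trans hw) m.succ_pos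
  have hTm : T.card ≤ m := Nat.le_of_mul_le_mul_right (hTw.trans hw) m.succ_pos
  have hG : E₂ᵀ * E₂ᵀ = 0 := by rw [← Matrix.transpose_mul, hE₂, Matrix.transpose_zero]
  obtain ⟨A, B, hAB, hA, hB⟩ : ∃ A B : Matrix ι ι F, A + B = s ∧ (∀ j, Aᵀ j ∈ kerCode E₁) ∧
      ∀ i, B i ∈ kerCode E₂ := by
    -- `E₁` kills the first summand by regularity; the second is killed by `E₂ᵀ` because `E₁ * s = s
    -- * E₂ᵀ` and `E₂ᵀ` squares to zero.
    refine ⟨s - g * E₁ * s, g * E₁ * s, sub_add_cancel _ _, fun j => ?_, fun i => ?_⟩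
    · have : E₁ * (s - g * E₁ * s) = 0 := by
        rw [mul_sub, ← mul_assoc, ← mul_assoc, hg, sub_self]
      exact funext fun i => congrFun (congrFun this i) j
    · have : g * E₁ * s * E₂ᵀ = 0 := by
        rw [mul_assoc g, hs, mul_assoc, mul_assoc s, hG, mul_zero, mul_zero]
      refine funext fun j => ?_
      have h' := congrFun (congrFun this i) j
      rw [Matrix.mul_apply'] at h'
      exact (dotProduct_comm _ _).trans h'
  have hsupp : ∀ i ∉ S, ∀ j ∉ T, s i j = 0 := by
    rw [← hAB]
    apply good A B hA hB S T hSm hTm <;> rw [hAB]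
    · intro i hi
      simpa [hS, Matrix.heavyRows] using hi
    · intro j hj
      simpa [hT, Matrix.heavyRows] using hj
  obtain ⟨P, hPE, hDP⟩ := Matrix.exists_left_inverse_coordProj (E := E₁) (S := S)
    fun x hx hxS => good.eq_zero hm hx (hxS.trans hSm)
  obtain ⟨Q, hQE, hDQ⟩ := Matrix.exists_left_inverse_coordProj (E := E₂) (S := T)
    fun x hx hxS => good.symm.eq_zero hm hx (hxS.trans hTm)
  have ht : (Matrix.coordProj F T)ᵀ = Matrix.coordProj F T := Matrix.diagonal_transpose _
  obtain ⟨M, hM, hsM⟩ := exists_filling_of_support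
    (h2 := fun x : Matrix ι ι F => by ext i j; exact CharTwo.add_self_eq_zero _)
    (E := E₁) (G := E₂ᵀ) (P := P) (Q := Qᵀ) (D := Matrix.coordProj F S)
    (D' := Matrix.coordProj F T) (s := s) hG hPE hDP
    (by rw [← ht, mul_assoc, ← Matrix.transpose_mul, ← Matrix.transpose_mul, hQE])
    (by rw [← ht, ← Matrix.transpose_mul, hDQ]) hs
    (by
      ext i j
      by_cases hi : i ∈ S
      · simp [Matrix.coordProj, hi]
      · by_cases hj : j ∈ T
        · simp [Matrix.coordProj, hi, hj, mul_add, CharTwo.add_self_eq_zero]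
        · simp [Matrix.coordProj, hi, hj, mul_add, hsupp i hi j hj])
    (Matrix.coordProj_mul_self T)
  refine ⟨M, hsM, ?_⟩
  have h1 : M.weight ≤ S.card * T.card := by
    apply Matrix.weight_le_of_support
    intro i j hij
    rw [← hM] at hij
    by_contra h
    rw [not_and_or] at h
    apply hij
    rcases h with h | h <;> simp [Matrix.coordProj, h]
  calc M.weight ≤ S.card * T.card := h1
    _ ≤ S.card * (m + 1) := Nat.mul_le_mul_left _ (hTm.trans m.le_succ)
    _ ≤ s.weight := hSw

end Filling

/-! ### Reindexing the checks of a tester -/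

section Tester

variable {F : Type*} [Field F] [DecidableEq F]

theorem hammingNorm_comp_equiv {α β : Type*} [Fintype α] [Fintype β] (e : α ≃ β) (x : β → F) :
    hammingNorm (fun a => x (e a)) = hammingNorm x := by
  simp only [hammingNorm, Finset.card_filter]
  exact Equiv.sum_comp e fun b => if x b ≠ 0 then 1 else 0

theorem IsTester.isLTC {ι κ : Type*} [Fintype ι] [Fintype κ] {H : Matrix κ ι F}
    {C : Submodule F (ι → F)} {w : ℕ} {ρ : ℝ} (h : IsTester H C w ρ) : IsLTC C w ρ := by
  classical
  obtain ⟨hC, hrow, hcol, hs⟩ := h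
  let e : Fin (Fintype.card κ) ≃ κ := (Fintype.equivFin κ).symm
  have hmul : ∀ x, (H.submatrix e id) *ᵥ x = fun i => (H *ᵥ x) (e i) := fun x => rfl
  refine ⟨Fintype.card κ, H.submatrix e id, ?_, fun i => hrow (e i), fun j => ?_, ?_⟩
  · rw [← hC]
    ext x
    rw [mem_kerCode, mem_kerCode, hmul]
    refine ⟨fun h => funext fun k => ?_, fun h => by rw [h]; rfl⟩
    have := congrFun h (e.symm k)
    simpa using this
  · exact (hammingNorm_comp_equiv e fun k => H k j).trans_le (hcol j)
  · rintro _ ⟨x, rfl⟩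
    obtain ⟨y, hy, hle⟩ := hs (H *ᵥ x) ⟨x, rfl⟩
    refine ⟨y, by rw [Matrix.mulVecLin_apply, hmul, hmul, hy], ?_⟩
    rw [Matrix.mulVecLin_apply, hmul, hammingNorm_comp_equiv e, Fintype.card_fin]
    exact hle

end Tester

/-! ### Parameters and soundness of the product complex -/

section ProductComplex

variable {F : Type*} [Field F] [DecidableEq F] {ι : Type*} [Fintype ι] [DecidableEq ι]

omit [DecidableEq F] in
theorem kroneckerSum_mulVec (E₁ E₂ M : Matrix ι ι F) :
    (E₁ ⊗ₖ (1 : Matrix ι ι F) + (1 : Matrix ι ι F) ⊗ₖ E₂) *ᵥ (fun p => M p.1 p.2) =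
      fun p => (E₁ * M + M * E₂ᵀ) p.1 p.2 := by
  ext ⟨i, j⟩
  rw [Matrix.add_mulVec]
  simp only [Pi.add_apply, Matrix.add_apply, Matrix.mulVec, dotProduct, Fintype.sum_prod_type,
    Matrix.kronecker_apply, Matrix.mul_apply, Matrix.transpose_apply, Matrix.one_apply]
  congr 1
  · simp
  · rw [Finset.sum_eq_single i]
    · simp [mul_comm]
    · intro b _ hb
      simp [hb.symm]
    · simp

omit [DecidableEq F] [Fintype ι] in
theorem transpose_kroneckerSum (E₁ E₂ : Matrix ι ι F) :
    (E₁ ⊗ₖ (1 : Matrix ι ι F) + (1 : Matrix ι ι F) ⊗ₖ E₂)ᵀ =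
      E₁ᵀ ⊗ₖ (1 : Matrix ι ι F) + (1 : Matrix ι ι F) ⊗ₖ E₂ᵀ := by
  rw [Matrix.transpose_add, ← Matrix.kroneckerMap_transpose, ← Matrix.kroneckerMap_transpose,
    Matrix.transpose_one]

/-- Each row is supported on a cross: one line in either direction through `p`. -/
theorem hammingNorm_row_kroneckerSum_le (E₁ E₂ : Matrix ι ι F) (p : ι × ι) :
    hammingNorm (fun q => (E₁ ⊗ₖ (1 : Matrix ι ι F) + (1 : Matrix ι ι F) ⊗ₖ E₂) p q) ≤
      2 * Fintype.card ι := by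
  have hsub : (Finset.univ.filter fun q : ι × ι =>
      (E₁ ⊗ₖ (1 : Matrix ι ι F) + (1 : Matrix ι ι F) ⊗ₖ E₂) p q ≠ 0) ⊆
      (Finset.univ.image fun a => (a, p.2)) ∪ Finset.univ.image fun b => (p.1, b) := by
    rintro ⟨a, b⟩ hq
    have hq := (Finset.mem_filter.1 hq).2
    rw [Finset.mem_union, Finset.mem_image, Finset.mem_image]
    by_contra h
    have hb : p.2 ≠ b := fun h' => h (Or.inl ⟨a, Finset.mem_univ _, by rw [h']⟩)
    have ha : p.1 ≠ a := fun h' => h (Or.inr ⟨b, Finset.mem_univ _, by rw [h']⟩)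
    apply hq
    simp [ha, hb]
  calc _ ≤ _ := Finset.card_le_card hsub
    _ ≤ _ := Finset.card_union_le _ _
    _ ≤ Fintype.card ι + Fintype.card ι := add_le_add Finset.card_image_le Finset.card_image_le
    _ = _ := (two_mul _).symm

theorem IsPairGood.exists_preimage [CharP F 2] {m : ℕ} (hm : 1 ≤ m) {E₁ E₂ g : Matrix ι ι F}
    (hg : E₁ * g * E₁ = E₁) (hE₂ : E₂ * E₂ = 0)
    (good : IsPairGood m (kerCode E₁) (kerCode E₂)) {x : ι × ι → F}
    (hx : x ∈ kerCode (E₁ ⊗ₖ (1 : Matrix ι ι F) + (1 : Matrix ι ι F) ⊗ₖ E₂))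
    (hw : hammingNorm x ≤ m * (m + 1)) :
    ∃ y, (E₁ ⊗ₖ (1 : Matrix ι ι F) + (1 : Matrix ι ι F) ⊗ₖ E₂) *ᵥ y = x ∧
      hammingNorm y ≤ hammingNorm x := by
  set s : Matrix ι ι F := Matrix.of fun i j => x (i, j) with hs
  have hsx : (fun p : ι × ι => s p.1 p.2) = x := rfl
  have hcyc : E₁ * s = s * E₂ᵀ := by
    rw [mem_kerCode, ← hsx, kroneckerSum_mulVec] at hx
    ext i j
    have := congrFun hx (i, j)
    exact CharTwo.add_eq_zero.1 this
  obtain ⟨M, hM, hMw⟩ := good.exists_filling hm hg hE₂ hcyc hw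
  exact ⟨fun p => M p.1 p.2, by rw [kroneckerSum_mulVec, ← hM, hsx], hMw⟩

/-- A syndrome is a cycle. If light, it is filled at no cost in weight; if heavier than m(m+1), any
preimage, of weight at most n², suffices by `hρ`. -/
theorem IsPairGood.isTester [CharP F 2] {m : ℕ} (hm : 1 ≤ m) {E₁ E₂ g : Matrix ι ι F}
    (hg : E₁ * g * E₁ = E₁) (hE₁ : E₁ * E₁ = 0) (hE₂ : E₂ * E₂ = 0)
    (good : IsPairGood m (kerCode E₁) (kerCode E₂)) {ρ : ℝ} (hρ₀ : 0 ≤ ρ) (hρ₁ : ρ ≤ 1)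
    (hρ : ρ * (Fintype.card ι : ℝ) ^ 2 ≤ m * (m + 1)) :
    IsTester (E₁ ⊗ₖ (1 : Matrix ι ι F) + (1 : Matrix ι ι F) ⊗ₖ E₂)
      (kerCode (E₁ ⊗ₖ (1 : Matrix ι ι F) + (1 : Matrix ι ι F) ⊗ₖ E₂))
      (2 * Fintype.card ι) ρ := by
  refine ⟨rfl, hammingNorm_row_kroneckerSum_le E₁ E₂, fun q => ?_, ?_⟩
  · have := hammingNorm_row_kroneckerSum_le E₁ᵀ E₂ᵀ q
    rwa [← transpose_kroneckerSum] at this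
  · rintro _ ⟨x, rfl⟩
    rw [Matrix.mulVecLin_apply]
    set D := E₁ ⊗ₖ (1 : Matrix ι ι F) + (1 : Matrix ι ι F) ⊗ₖ E₂ with hD
    have hDD : D * D = 0 :=
      ((⟨E₁, hE₁⟩ : SSComplex F ι).prod (⟨E₂, hE₂⟩ : SSComplex F ι)).bd_sq
    suffices h : ∃ e, D *ᵥ e = D *ᵥ x ∧ ρ * hammingNorm e ≤ hammingNorm (D *ᵥ x) by
      obtain ⟨e, he, hle⟩ := h
      refine ⟨e, he, ?_⟩
      rw [← mul_div_assoc]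
      gcongr
    by_cases hw : hammingNorm (D *ᵥ x) ≤ m * (m + 1)
    · obtain ⟨e, he, hle⟩ := good.exists_preimage hm hg hE₂ (x := D *ᵥ x)
        (by rw [mem_kerCode, Matrix.mulVec_mulVec, ← hD, hDD, Matrix.zero_mulVec]) hw
      refine ⟨e, he, ?_⟩
      calc ρ * hammingNorm e ≤ 1 * hammingNorm e := by gcongr
        _ ≤ _ := by rw [one_mul]; exact_mod_cast hle
    · refine ⟨x, rfl, ?_⟩
      have h1 : (hammingNorm x : ℝ) ≤ (Fintype.card ι : ℝ) ^ 2 := by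
        have := hammingNorm_le_card_fintype (x := x)
        rw [Fintype.card_prod, ← pow_two] at this
        exact_mod_cast this
      calc ρ * hammingNorm x ≤ ρ * (Fintype.card ι : ℝ) ^ 2 := by gcongr
        _ ≤ m * (m + 1) := hρ
        _ ≤ hammingNorm (D *ᵥ x) := by exact_mod_cast (not_le.1 hw).le

omit [DecidableEq F] [DecidableEq ι] in
theorem kerCode_mul_of_injective {κ μ : Type*} [Fintype κ] [DecidableEq κ] [Fintype μ]
    {A : Matrix μ κ F}
    {L : Matrix κ μ F} (hL : L * A = 1) (B : Matrix κ ι F) : kerCode (A * B) = kerCode B := by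
  ext x
  rw [mem_kerCode, mem_kerCode, ← Matrix.mulVec_mulVec]
  refine ⟨fun h => ?_, fun h => by rw [h, Matrix.mulVec_zero]⟩
  have := congrArg (L *ᵥ ·) h
  simpa [← Matrix.mul_assoc, hL] using this

omit [DecidableEq F] [DecidableEq ι] in
theorem kerCode_transpose_mul {r : ℕ} {A : Matrix (Fin r) ι F} (hA : A.rank = r)
    (B : Matrix (Fin r) ι F) : kerCode (Aᵀ * B) = kerCode B := by
  obtain ⟨L, hL⟩ := Matrix.exists_mul_eq_one_of_rank_eq hA
  exact kerCode_mul_of_injective (L := Lᵀ)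
    (by rw [← Matrix.transpose_mul, hL, Matrix.transpose_one]) B

omit [DecidableEq F] in
theorem CSSCode.dim_eq_rank {d h π : Matrix ι ι F} (hd : d * d = 0) (H : IsHomotopy d h π)
    (Q : CSSCode F ι) (hX : Q.QX = kerCode dᵀ) (hZ : Q.QZ = kerCode d) : Q.dim = π.rank := by
  rw [CSSCode.dim, hX, hZ, dualCode_kerCode, H.finrank_kerCode hd, Matrix.transpose_transpose]
  change d.rank + π.rank - d.rank = π.rank
  exact Nat.add_sub_cancel_left ..

theorem SSComplex.prod_properties [CharP F 2] {m : ℕ} (hm : 1 ≤ m) {Q₁ Q₂ : CSSCode F ι}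
    (goodX : IsPairGood m Q₁.QX Q₂.QX) (goodZ : IsPairGood m Q₁.QZ Q₂.QZ)
    {ρ : ℝ} (hρ₀ : 0 ≤ ρ) (hρ₁ : ρ ≤ 1) (hρ : ρ * (Fintype.card ι : ℝ) ^ 2 ≤ m * (m + 1))
    {r₁ r₂ : ℕ} {HX₁ HZ₁ : Matrix (Fin r₁) ι F} {HX₂ HZ₂ : Matrix (Fin r₂) ι F}
    (hX₁ : IsFullRankParityCheck HX₁ Q₁.QX) (hZ₁ : IsFullRankParityCheck HZ₁ Q₁.QZ)
    (hX₂ : IsFullRankParityCheck HX₂ Q₂.QX) (hZ₂ : IsFullRankParityCheck HZ₂ Q₂.QZ)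
    {A : SSComplex F (ι × ι)}
    (hA : A = (ofCSS Q₁ HX₁ HZ₁ hX₁ hZ₁).prod (ofCSS Q₂ HX₂ HZ₂ hX₂ hZ₂)) :
    A.toCSS.HasParams (Fintype.card ι ^ 2) (Q₁.dim * Q₂.dim) (ρ * (Fintype.card ι : ℝ) ^ 2) ∧
      A.toCSS.IsLTC (2 * Fintype.card ι) ρ ∧
      IsTester A.bdᵀ A.toCSS.QX (2 * Fintype.card ι) ρ ∧
      IsTester A.bd A.toCSS.QZ (2 * Fintype.card ι) ρ := by
  obtain ⟨d₁, sq₁, hd₁⟩ : ∃ d, d * d = 0 ∧ d = (ofCSS Q₁ HX₁ HZ₁ hX₁ hZ₁).bd :=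
    ⟨_, (ofCSS Q₁ HX₁ HZ₁ hX₁ hZ₁).bd_sq, rfl⟩
  obtain ⟨d₂, sq₂, hd₂⟩ : ∃ d, d * d = 0 ∧ d = (ofCSS Q₂ HX₂ HZ₂ hX₂ hZ₂).bd :=
    ⟨_, (ofCSS Q₂ HX₂ HZ₂ hX₂ hZ₂).bd_sq, rfl⟩
  have eZ₁ : kerCode d₁ = Q₁.QZ := by rw [hd₁, ← hZ₁.1]; exact kerCode_transpose_mul hX₁.2 _
  have eZ₂ : kerCode d₂ = Q₂.QZ := by rw [hd₂, ← hZ₂.1]; exact kerCode_transpose_mul hX₂.2 _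
  have t₁ : d₁ᵀ = HZ₁ᵀ * HX₁ := by simp [hd₁, ofCSS, Matrix.transpose_mul]
  have t₂ : d₂ᵀ = HZ₂ᵀ * HX₂ := by simp [hd₂, ofCSS, Matrix.transpose_mul]
  have eX₁ : kerCode d₁ᵀ = Q₁.QX := by rw [t₁, ← hX₁.1]; exact kerCode_transpose_mul hZ₁.2 _
  have eX₂ : kerCode d₂ᵀ = Q₂.QX := by rw [t₂, ← hX₂.1]; exact kerCode_transpose_mul hZ₂.2 _
  obtain ⟨h₁, π₁, H₁⟩ : ∃ h π, IsHomotopy d₁ h π := by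
    rw [hd₁]
    refine exists_isHomotopy hX₁.2 hZ₁.2 (dual_kerCode_le _ _ ?_)
    rw [hX₁.1, hZ₁.1]
    exact Q₁.css
  obtain ⟨h₂, π₂, H₂⟩ : ∃ h π, IsHomotopy d₂ h π := by
    rw [hd₂]
    refine exists_isHomotopy hX₂.2 hZ₂.2 (dual_kerCode_le _ _ ?_)
    rw [hX₂.1, hZ₂.1]
    exact Q₂.css
  have hbd : A.bd = d₁ ⊗ₖ (1 : Matrix ι ι F) + (1 : Matrix ι ι F) ⊗ₖ d₂ := by
    rw [hA, hd₁, hd₂]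
    rfl
  have hbdt : A.bdᵀ = d₁ᵀ ⊗ₖ (1 : Matrix ι ι F) + (1 : Matrix ι ι F) ⊗ₖ d₂ᵀ := by
    rw [hbd, transpose_kroneckerSum]
  have sqt : ∀ {d : Matrix ι ι F}, d * d = 0 → dᵀ * dᵀ = 0 := fun h => by
    rw [← Matrix.transpose_mul, h, Matrix.transpose_zero]
  rw [← eX₁, ← eX₂] at goodX
  rw [← eZ₁, ← eZ₂] at goodZ
  have regZ := H₁.regular sq₁
  have regX := H₁.transpose.regular (sqt sq₁)
  have hQX : A.toCSS.QX = kerCode A.bdᵀ := rfl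
  have hQZ : A.toCSS.QZ = kerCode A.bd := rfl
  have testX : IsTester A.bdᵀ A.toCSS.QX (2 * Fintype.card ι) ρ := by
    rw [hQX, hbdt]
    exact goodX.isTester hm regX (sqt sq₁) (sqt sq₂) hρ₀ hρ₁ hρ
  have testZ : IsTester A.bd A.toCSS.QZ (2 * Fintype.card ι) ρ := by
    rw [hQZ, hbd]
    exact goodZ.isTester hm regZ sq₁ sq₂ hρ₀ hρ₁ hρ
  refine ⟨⟨by rw [Fintype.card_prod, pow_two], ?_, ?_⟩, ⟨testX.isLTC, testZ.isLTC⟩, testX, testZ⟩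
  · have hdim : A.toCSS.dim = (π₁ ⊗ₖ π₂).rank :=
      CSSCode.dim_eq_rank A.bd_sq (hbd ▸ H₁.prod H₂) _ hQX hQZ
    rw [hdim, Matrix.rank_kronecker, ← CSSCode.dim_eq_rank sq₁ H₁ Q₁ eX₁.symm eZ₁.symm,
      ← CSSCode.dim_eq_rank sq₂ H₂ Q₂ eX₂.symm eZ₂.symm, Nat.cast_mul]
  · have hle : ((m * (m + 1) : ℕ) : ℕ∞) ≤ A.toCSS.distance := by
      refine le_iInf₂ fun c hc => ?_
      rw [Nat.cast_le]
      by_contra hlt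
      rw [not_le] at hlt
      rcases hc with ⟨hc, hc'⟩ | ⟨hc, hc'⟩
      · apply hc'
        change c ∈ dualCode (kerCode A.bd)
        rw [dualCode_kerCode, hbdt]
        replace hc : c ∈ kerCode A.bdᵀ := hc
        rw [hbdt] at hc
        obtain ⟨y, hy, -⟩ := goodX.exists_preimage hm regX (sqt sq₂) hc hlt.le
        exact ⟨y, hy⟩
      · apply hc'
        change c ∈ dualCode (kerCode A.bdᵀ)
        rw [dualCode_kerCode, Matrix.transpose_transpose, hbd]
        replace hc : c ∈ kerCode A.bd := hc
        rw [hbd] at hc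
        obtain ⟨y, hy, -⟩ := goodZ.exists_preimage hm regZ sq₂ hc hlt.le
        exact ⟨y, hy⟩
    calc ENNReal.ofReal (ρ * (Fintype.card ι : ℝ) ^ 2)
        ≤ ENNReal.ofReal ((m * (m + 1) : ℕ) : ℝ) :=
          ENNReal.ofReal_le_ofReal (by exact_mod_cast hρ)
      _ = (((m * (m + 1) : ℕ) : ℕ∞) : ℝ≥0∞) := by
          rw [ENNReal.ofReal_natCast]; rfl
      _ ≤ _ := by exact_mod_cast hle

end ProductComplex

/-! ### Independent families, coordinate subspaces and rank decompositions -/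

section LinearAlgebra

variable {F : Type*} [Field F]

theorem Submodule.exists_linearIndependent_mem {V : Type*} [AddCommGroup V] [Module F V]
    [FiniteDimensional F V] (W : Submodule F V) {k : ℕ} (hk : k ≤ Module.finrank F W) :
    ∃ f : Fin k → V, LinearIndependent F f ∧ ∀ j, f j ∈ W := by
  let b := Module.finBasis F W
  refine ⟨fun j => b (Fin.castLE hk j), ?_, fun j => (b _).2⟩
  have h1 := b.linearIndependent.comp (Fin.castLE hk) (Fin.castLE_injective hk)
  exact h1.map' W.subtype W.ker_subtype

open Classical in
/-- A choice of `k` linearly independent vectors of `W`, if `k` is at most the dimension of `W`. -/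
noncomputable def Submodule.indepFamily {V : Type*} [AddCommGroup V] [Module F V]
    (W : Submodule F V) (k : ℕ) : Fin k → V :=
  if h : ∃ f : Fin k → V, LinearIndependent F f ∧ ∀ j, f j ∈ W then h.choose else 0

theorem Submodule.indepFamily_spec {V : Type*} [AddCommGroup V] [Module F V]
    [FiniteDimensional F V] (W : Submodule F V) {k : ℕ} (hk : k ≤ Module.finrank F W) :
    LinearIndependent F (W.indepFamily k) ∧ ∀ j, W.indepFamily k j ∈ W := by
  have h := W.exists_linearIndependent_mem hk
  rw [indepFamily, dif_pos h]
  exact h.choose_spec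

theorem Submodule.exists_le_span_range {V : Type*} [AddCommGroup V] [Module F V]
    [FiniteDimensional F V] (W : Submodule F V) {t : ℕ} (ht : Module.finrank F W ≤ t) :
    ∃ f : Fin t → V, W ≤ span F (Set.range f) := by
  let b := Module.finBasis F W
  -- Padding with zeros makes the number of vectors exactly `t`, whatever the dimension.
  refine ⟨fun j => if h : (j : ℕ) < Module.finrank F W then b ⟨j, h⟩ else 0, fun x hx => ?_⟩
  have h1 := b.sum_repr ⟨x, hx⟩
  have h2 := congrArg W.subtype h1
  rw [map_sum] at h2
  change _ = x at h2
  rw [← h2]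
  refine sum_mem fun i _ => ?_
  rw [map_smul]
  refine smul_mem _ _ (subset_span ⟨Fin.castLE ht i, ?_⟩)
  simp

/-- The coordinate subspace of vectors supported on `S`. -/
def supportedOn (F : Type*) [Field F] {ι : Type*} (S : Finset ι) : Submodule F (ι → F) where
  carrier := {x | ∀ i ∉ S, x i = 0}
  zero_mem' := fun _ _ => rfl
  add_mem' := fun {a b} ha hb i hi => by rw [Pi.add_apply, ha i hi, hb i hi, add_zero]
  smul_mem' := fun c x hx i hi => by rw [Pi.smul_apply, hx i hi, smul_zero]

theorem hammingNorm_le_of_mem_supportedOn [DecidableEq F] {ι : Type*} [Fintype ι] {S : Finset ι}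
    {x : ι → F} (hx : x ∈ supportedOn F S) : hammingNorm x ≤ S.card :=
  Finset.card_le_card fun i hi => by
    by_contra h
    exact (Finset.mem_filter.1 hi).2 (hx i h)

/-- Erasing the coordinates in `S` maps `w j + u j` back to `w j`. -/
theorem LinearIndependent.add_of_mem_supportedOn {ι κ : Type*} {S : Finset ι}
    {w u : κ → ι → F} (hw : LinearIndependent F w) (hwS : ∀ j, ∀ i ∈ S, w j i = 0)
    (hu : ∀ j, u j ∈ supportedOn F S) : LinearIndependent F fun j => w j + u j := by
  classical
  let p : (ι → F) →ₗ[F] (ι → F) :=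
    LinearMap.pi fun i => if i ∈ S then 0 else LinearMap.proj i
  have hp : p ∘ (fun j => w j + u j) = w := by
    ext j i
    by_cases hi : i ∈ S
    · simp [p, hi, hwS j i hi]
    · simp [p, hi, hu j i hi]
  exact LinearIndependent.of_comp p (by rw [hp]; exact hw)

theorem apply_eq_zero_of_mem_dualCode {ι : Type*} [Fintype ι] {C : Submodule F (ι → F)}
    {S : Finset ι} {y : ι → F} (hy : y ∈ dualCode (C ⊔ supportedOn F S)) {i : ι} (hi : i ∈ S) :
    y i = 0 := by
  classical
  have h : Pi.single i 1 ∈ supportedOn F S := by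
    intro k hk
    rw [Pi.single_apply, if_neg]
    rintro rfl
    exact hk hi
  simpa using hy _ (Submodule.mem_sup_right h)

theorem Matrix.exists_columns {ι κ : Type*} [Fintype ι] [Fintype κ] (Z : Matrix ι κ F) {r : ℕ}
    (hr : Z.rank = r) :
    ∃ J : Fin r → κ, LinearIndependent F (fun k => Zᵀ (J k)) ∧
      ∃ W : Matrix (Fin r) κ F, Z = Z.submatrix id J * W := by
  obtain ⟨μ, a, ha, hspan, hli⟩ := exists_linearIndependent' F (fun j => Zᵀ j)
  have : Finite μ := Finite.of_injective a ha
  have : Fintype μ := Fintype.ofFinite μ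
  have hcard : Fintype.card μ = r := by
    rw [← hr, Z.rank_eq_finrank_span_cols]
    have h1 := finrank_span_eq_card hli
    rw [hspan] at h1
    exact h1.symm
  let e : Fin r ≃ μ := (Fintype.equivFinOfCardEq hcard).symm
  refine ⟨a ∘ e, hli.comp e e.injective, ?_⟩
  have hmem : ∀ j, ∃ c : Fin r → F, ∑ k, c k • Zᵀ (a (e k)) = Zᵀ j := by
    intro j
    have : Zᵀ j ∈ Submodule.span F (Set.range fun k => Zᵀ (a (e k))) := by
      have h2 : Set.range (fun k => Zᵀ (a (e k))) = Set.range ((fun j => Zᵀ j) ∘ a) :=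
        e.surjective.range_comp ((fun j => Zᵀ j) ∘ a)
      rw [h2, hspan]
      exact Submodule.subset_span ⟨j, rfl⟩
    exact (Submodule.mem_span_range_iff_exists_fun F).1 this
  choose c hc using hmem
  refine ⟨Matrix.of fun k j => c j k, ?_⟩
  ext i j
  have := congrFun (hc j) i
  simp only [Finset.sum_apply, Pi.smul_apply, transpose_apply, smul_eq_mul] at this
  rw [← this, mul_apply]
  exact Finset.sum_congr rfl fun k _ => mul_comm _ _

/-- The rank `r` matrix with the prescribed columns `v` that span its column space and the
prescribed rows `y` in the positions `I`. -/
noncomputable def Matrix.ofRowsCols {ι : Type*} {r : ℕ} (v : Fin r → ι → F) (I : Fin r → ι)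
    (y : Fin r → ι → F) : Matrix ι ι F :=
  (Matrix.of v)ᵀ * ((Matrix.of v)ᵀ.submatrix I id)⁻¹ * Matrix.of y

/-- Independent columns V have an invertible minor on some rows `I`, and X = V W then recovers W
from the rows `I` of X. The point is that a sparse matrix of rank r costs only 2r sparse vectors and
r positions. -/
theorem Matrix.exists_eq_ofRowsCols {ι : Type*} [Fintype ι] (X : Matrix ι ι F) {r : ℕ}
    (hr : X.rank = r) :
    ∃ I J : Fin r → ι, LinearIndependent F (fun k => Xᵀ (J k)) ∧
      X = ofRowsCols (fun k => Xᵀ (J k)) I (fun k => X (I k)) := by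
  obtain ⟨J, hJ, W, hW⟩ := X.exists_columns hr
  set V : Matrix ι (Fin r) F := X.submatrix id J with hV
  have hVr : Vᵀ.rank = r := by
    have := LinearIndependent.rank_matrix (M := Vᵀ) hJ
    simpa using this
  obtain ⟨I, hI, -⟩ := Vᵀ.exists_columns hVr
  refine ⟨I, J, hJ, ?_⟩
  have hunit : IsUnit (V.submatrix I id).det := by
    rw [← isUnit_iff_isUnit_det]
    exact linearIndependent_rows_iff_isUnit.1 hI
  have hY : (Matrix.of fun k => X (I k)) = V.submatrix I id * W := by
    ext k j
    exact congrFun (congrFun hW (I k)) j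
  change X = V * (V.submatrix I id)⁻¹ * Matrix.of fun k => X (I k)
  rw [hY, Matrix.mul_assoc, nonsing_inv_mul_cancel_left _ _ hunit]
  exact hW

end LinearAlgebra

/-! ### Bad events behind a failure of product expansion -/

section BadEvents

variable {F : Type*} [Field F] [DecidableEq F] {ι : Type*} [Fintype ι]

/-- Vectors of weight at most `m`. -/
abbrev SparseVec (F : Type*) [Field F] [DecidableEq F] (ι : Type*) [Fintype ι] (m : ℕ) : Type _ :=
  {v : ι → F // hammingNorm v ≤ m}

/-- `C` meets a sparse `r`-dimensional space, up to sparse errors, in codimension at most `t`. -/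
def MeetsSparse (m r t : ℕ) (C : Submodule F (ι → F))
    (p : (Fin r → SparseVec F ι m) × Matrix (Fin t) (Fin r) F × (Fin (r - t) → SparseVec F ι m)) :
    Prop :=
  LinearIndependent F (fun j => (∑ i, (kerCode p.2.1).indepFamily (r - t) j i • (p.1 i : ι → F)) +
      p.2.2 j) ∧
    ∀ j, (∑ i, (kerCode p.2.1).indepFamily (r - t) j i • (p.1 i : ι → F)) + p.2.2 j ∈ C

/-- The image under `X`, from the left, of the checks of `C` that vanish on `S`. -/
def checkImage (C : Submodule F (ι → F)) (S : Finset ι) (X : Matrix ι ι F) :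
    Submodule F (ι → F) :=
  (dualCode (C ⊔ supportedOn F S)).map X.vecMulLinear

/-- `C₂` contains, up to sparse errors, `t + 1` independent images of checks of `C₁`. -/
def MeetsChecks (m r t : ℕ) (C₁ C₂ : Submodule F (ι → F))
    (p : {S : Finset ι // S.card ≤ m} × (Fin r → SparseVec F ι m) × (Fin r → ι) ×
      (Fin r → SparseVec F ι m) × (Fin (t + 1) → SparseVec F ι m)) : Prop :=
  LinearIndependent F (fun j => (checkImage C₁ p.1 (Matrix.ofRowsCols (fun k => (p.2.1 k : ι → F))
      p.2.2.1 fun k => (p.2.2.2.1 k : ι → F))).indepFamily (t + 1) j + p.2.2.2.2 j) ∧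
    ∀ j, (checkImage C₁ p.1 (Matrix.ofRowsCols (fun k => (p.2.1 k : ι → F))
      p.2.2.1 fun k => (p.2.2.2.1 k : ι → F))).indepFamily (t + 1) j + p.2.2.2.2 j ∈ C₂

/-- Delete the rows `S` and columns `T` from `A + B` and compare `t` with the dimension of the image
of the checks: a large image forces words into `C₂`, a small one forces words into `C₁`. -/
theorem exists_meets_of_not_isPairGood {m : ℕ} (t : ℕ → ℕ) {C₁ C₂ : Submodule F (ι → F)}
    (h : ¬ IsPairGood m C₁ C₂) :
    ∃ r, 1 ≤ r ∧ r ≤ Fintype.card ι ∧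
      ((∃ p, MeetsSparse m r (t r) C₁ p) ∨ ∃ p, MeetsChecks m r (t r) C₁ C₂ p) := by
  classical
  simp only [IsPairGood, not_forall] at h
  obtain ⟨A, B, hA, hB, S, T, hS, hT, hrow, hcol, i₀, hi₀, j₀, hj₀, hne⟩ := h
  set X : Matrix ι ι F := Matrix.of fun i j => if i ∈ S ∨ j ∈ T then 0 else (A + B) i j with hX
  have hXrow : ∀ i, hammingNorm (X i) ≤ m := by
    intro i
    by_cases hi : i ∈ S
    · have : X i = 0 := by ext j; simp [hX, hi]
      simp [this]
    · refine le_trans (Finset.card_le_card fun j hj => ?_) (hrow i hi)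
      have hj := (Finset.mem_filter.1 hj).2
      simp only [hX, Matrix.of_apply] at hj
      split_ifs at hj with h
      · exact absurd rfl hj
      · exact Finset.mem_filter.2 ⟨Finset.mem_univ _, hj⟩
  have hXcol : ∀ j, hammingNorm (Xᵀ j) ≤ m := by
    intro j
    by_cases hj : j ∈ T
    · have : Xᵀ j = 0 := by ext i; simp [hX, hj]
      simp [this]
    · refine le_trans (Finset.card_le_card fun i hi => ?_) (hcol j hj)
      have hi := (Finset.mem_filter.1 hi).2
      simp only [hX, Matrix.of_apply, Matrix.transpose_apply] at hi
      split_ifs at hi with h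
      · exact absurd rfl hi
      · exact Finset.mem_filter.2 ⟨Finset.mem_univ _, hi⟩
  have hX0 : X ≠ 0 := by
    intro h
    apply hne
    have := congrFun (congrFun h i₀) j₀
    simpa [hX, hi₀, hj₀] using this
  obtain ⟨I, J, hJ, hdec⟩ := X.exists_eq_ofRowsCols rfl
  refine ⟨X.rank, ?_, X.rank_le_card_width, ?_⟩
  · rw [Nat.one_le_iff_ne_zero]
    intro h0
    apply hX0
    have hbot : LinearMap.range X.mulVecLin = ⊥ := Submodule.finrank_eq_zero.1 h0
    rw [LinearMap.range_eq_bot] at hbot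
    ext i j
    have := congrFun (LinearMap.congr_fun hbot (Pi.single j 1)) i
    simpa using this
  generalize t X.rank = t
  rcases le_or_gt (t + 1) (Module.finrank F (checkImage C₁ S X)) with hge | hlt
  · right
    obtain ⟨hli, hmem⟩ := (checkImage C₁ S X).indepFamily_spec hge
    set w := (checkImage C₁ S X).indepFamily (t + 1) with hw
    choose y hy hyw using hmem
    have hyw : ∀ j, y j ᵥ* X = w j := hyw
    have hwT : ∀ j, ∀ i ∈ T, w j i = 0 := by
      intro j i hi
      rw [← hyw, Matrix.vecMul]
      exact Finset.sum_eq_zero fun k _ => by simp [hX, hi]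
    -- A check `y j` vanishes on `S` and annihilates the columns of `A`, so off `T` only `B`
    -- contributes.
    have hwTc : ∀ j, ∀ i ∉ T, w j i = (y j ᵥ* B) i := by
      intro j i hi
      have h1 : w j i = (y j ᵥ* (A + B)) i := by
        rw [← hyw]
        refine Finset.sum_congr rfl fun k _ => ?_
        by_cases hk : k ∈ S
        · rw [apply_eq_zero_of_mem_dualCode (hy j) hk, zero_mul, zero_mul]
        · simp [hX, hi, hk]
      have h2 : (y j ᵥ* A) i = 0 := hy j _ (Submodule.mem_sup_left (hA i))
      rw [h1, Matrix.vecMul_add, Pi.add_apply, h2, zero_add]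
    set u : Fin (t + 1) → ι → F := fun j i => if i ∈ T then (y j ᵥ* B) i else 0 with hu
    have huT : ∀ j, u j ∈ supportedOn F T := fun j i hi => if_neg hi
    have hsum : ∀ j, w j + u j = y j ᵥ* B := by
      intro j
      ext i
      by_cases hi : i ∈ T
      · simp [hu, hi, hwT j i hi]
      · simp [hu, hi, hwTc j i hi]
    refine ⟨(⟨S, hS⟩, fun k => ⟨Xᵀ (J k), hXcol _⟩, I, fun k => ⟨X (I k), hXrow _⟩,
      fun j => ⟨u j, (hammingNorm_le_of_mem_supportedOn (huT j)).trans hT⟩), ?_⟩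
    simp only [MeetsChecks]
    rw [← hdec, ← hw]
    refine ⟨hli.add_of_mem_supportedOn hwT huT, fun j => ?_⟩
    rw [hsum, Matrix.vecMul_eq_sum]
    exact sum_mem fun i _ => Submodule.smul_mem _ _ (hB i)
  · left
    set V : Matrix ι (Fin X.rank) F := X.submatrix id J with hV
    let φ : (ι → F) →ₗ[F] (Fin X.rank → F) := LinearMap.funLeft F F J
    -- The checks paired with the chosen columns `V` span at most `t` dimensions. Coefficients `f`
    -- in the kernel of `K` make `V *ᵥ f` orthogonal to all these checks, so it lies in `C₁ ⊔
    -- supportedOn F S` by double duality.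
    obtain ⟨K, hK⟩ := ((checkImage C₁ S X).map φ).exists_le_span_range (t := t)
      ((Submodule.finrank_map_le _ _).trans (Nat.lt_succ_iff.1 hlt))
    have hker : X.rank - t ≤ Module.finrank F (kerCode (Matrix.of K)) := by
      have h1 := LinearMap.finrank_range_add_finrank_ker (Matrix.of K).mulVecLin
      have h2 := (Matrix.of K).rank_le_height
      rw [Module.finrank_fin_fun] at h1
      change (Matrix.of K).rank + Module.finrank F (kerCode (Matrix.of K)) = X.rank at h1
      omega
    obtain ⟨hli, hmem⟩ := (kerCode (Matrix.of K)).indepFamily_spec hker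
    set f := (kerCode (Matrix.of K)).indepFamily (X.rank - t) with hf
    have hVf : ∀ j, (∑ i, f j i • Xᵀ (J i)) = V *ᵥ f j := by
      intro j
      ext i
      simp [Matrix.mulVec, dotProduct, hV, mul_comm]
    have hVli : LinearIndependent F fun j => V *ᵥ f j := by
      have hinj : LinearMap.ker V.mulVecLin = ⊥ :=
        LinearMap.ker_eq_bot.2 (Matrix.mulVec_injective_iff.2 hJ)
      exact hli.map' V.mulVecLin hinj
    have hVS : ∀ j, ∀ i ∈ S, (V *ᵥ f j) i = 0 := by
      intro j i hi
      rw [Matrix.mulVec]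
      exact Finset.sum_eq_zero fun k _ => by simp [hV, hX, hi]
    have hVmem : ∀ j, V *ᵥ f j ∈ C₁ ⊔ supportedOn F S := by
      intro j
      rw [← dualCode_dualCode (C₁ ⊔ supportedOn F S)]
      intro y hy
      rw [dotProduct_comm, Matrix.dotProduct_mulVec]
      have h1 : y ᵥ* V ∈ Submodule.span F (Set.range K) := hK ⟨y ᵥ* X, ⟨y, hy, rfl⟩, rfl⟩
      have h2 : Submodule.span F (Set.range K) ≤ dualCode (kerCode (Matrix.of K)) := by
        rw [Submodule.span_le]
        rintro _ ⟨i, rfl⟩ x hx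
        exact congrFun hx i
      exact h2 h1 _ (hmem j)
    choose c hc e he hce using fun j => Submodule.mem_sup.1 (hVmem j)
    have heS : ∀ j, -e j ∈ supportedOn F S := fun j => Submodule.neg_mem _ (he j)
    refine ⟨(fun k => ⟨Xᵀ (J k), hXcol _⟩, Matrix.of K,
      fun j => ⟨-e j, (hammingNorm_le_of_mem_supportedOn (heS j)).trans hS⟩), ?_⟩
    simp only [MeetsSparse]
    rw [← hf]
    simp only [hVf]
    refine ⟨hVli.add_of_mem_supportedOn hVS heS, fun j => ?_⟩
    rw [← hce, add_neg_cancel_right]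
    exact hc j

end BadEvents

/-! ### Counting codes through given vectors, and sparse vectors -/

section Counting

theorem Nat.card_exists_mul_le {α Ω : Type*} [Finite α] [Finite Ω] (P : α → Ω → Prop) {a b : ℕ}
    (h : ∀ i, Nat.card {ω // P i ω} * a ≤ b) :
    Nat.card {ω // ∃ i, P i ω} * a ≤ Nat.card α * b := by
  have : Fintype α := Fintype.ofFinite α
  have h1 : Nat.card {ω // ∃ i, P i ω} ≤ Nat.card (Σ i, {ω // P i ω}) :=
    Nat.card_le_card_of_surjective
      (fun x : Σ i, {ω // P i ω} => (⟨x.2.1, x.1, x.2.2⟩ : {ω // ∃ i, P i ω}))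
      fun ⟨ω, i, hi⟩ => ⟨⟨i, ω, hi⟩, rfl⟩
  rw [Nat.card_sigma] at h1
  calc Nat.card {ω // ∃ i, P i ω} * a ≤ (∑ i, Nat.card {ω // P i ω}) * a := by gcongr
    _ = ∑ i, Nat.card {ω // P i ω} * a := Finset.sum_mul ..
    _ ≤ ∑ _i : α, b := Finset.sum_le_sum fun i _ => h i
    _ = Nat.card α * b := by simp

variable {F : Type*} [Field F] {ι : Type*} [Fintype ι]

/-- In the finite family `c`, the proportion of codes containing `s` given independent vectors is
at most `q ^ (-d s)`. -/
def IsSpread {Ω : Type*} (c : Ω → Submodule F (ι → F)) (d : ℕ) : Prop :=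
  ∀ (s : ℕ) (w : Fin s → ι → F), LinearIndependent F w →
    Nat.card {ω // ∀ j, w j ∈ c ω} * Nat.card F ^ (d * s) ≤ Nat.card Ω

theorem LinearIndependent.exists_linearEquiv {V : Type*} [AddCommGroup V] [Module F V]
    [FiniteDimensional F V] {s : ℕ} {w w' : Fin s → V} (hw : LinearIndependent F w)
    (hw' : LinearIndependent F w') : ∃ g : V ≃ₗ[F] V, ∀ j, g (w j) = w' j := by
  obtain ⟨g, hg⟩ := Submodule.exists_linearEquiv_restrict_eq
    ((Module.Basis.span hw).equiv (Module.Basis.span hw') (Equiv.refl _))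
  refine ⟨g, fun j => ?_⟩
  have h1 := hg (Module.Basis.span hw j)
  rw [Module.Basis.equiv_apply, Equiv.refl_apply, Module.Basis.span_apply,
    Module.Basis.span_apply] at h1
  exact h1.symm

theorem card_linearIndependent_mem [Finite F] (W : Submodule F (ι → F)) {s : ℕ}
    (hs : s ≤ Module.finrank F W) :
    Nat.card {w : {w : Fin s → ι → F // LinearIndependent F w} // ∀ j, w.1 j ∈ W} =
      ∏ i : Fin s, (Nat.card F ^ Module.finrank F W - Nat.card F ^ (i : ℕ)) := by
  have : Fintype F := Fintype.ofFinite F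
  rw [Nat.card_eq_fintype_card (α := F), ← card_linearIndependent hs]
  refine Nat.card_congr ⟨fun w => ⟨fun j => ⟨w.1.1 j, w.2 j⟩, ?_⟩,
    fun w => ⟨⟨fun j => w.1 j, w.2.map' W.subtype W.ker_subtype⟩, fun j => (w.1 j).2⟩,
    fun _ => rfl, fun _ => rfl⟩
  exact LinearIndependent.of_comp W.subtype w.1.2

/-- Linear automorphisms act transitively on independent s-tuples, so the number of codes containing
a tuple does not depend on it. Double counting gives the ratio ∏ (q^k − q^i)/(q^n − q^i), each
factor being at most q^(k−n). -/
theorem isSpread_of_linearEquiv [Finite F] {Ω : Type*} [Finite Ω] {c : Ω → Submodule F (ι → F)}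
    {k : ℕ} (hk : ∀ ω, Module.finrank F (c ω) = k)
    (hg : ∀ g : (ι → F) ≃ₗ[F] (ι → F), ∃ a : Ω → Ω, Function.Injective a ∧
      ∀ ω, c (a ω) = (c ω).map g.toLinearMap) :
    IsSpread c (Fintype.card ι - k) := by
  have : Fintype F := Fintype.ofFinite F
  have : Fintype Ω := Fintype.ofFinite Ω
  intro s w hw
  set n := Fintype.card ι with hn
  set q := Nat.card F with hq
  have hq1 : 1 < q := Finite.one_lt_card
  rcases le_or_gt s k with hsk | hks
  swap
  · have : IsEmpty {ω // ∀ j, w j ∈ c ω} := by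
      refine ⟨fun ⟨ω, hω⟩ => ?_⟩
      have h1 : LinearIndependent F fun j => (⟨w j, hω j⟩ : c ω) :=
        LinearIndependent.of_comp (c ω).subtype hw
      have h2 := h1.fintype_card_le_finrank
      rw [hk, Fintype.card_fin] at h2
      omega
    simp
  rcases isEmpty_or_nonempty Ω with hΩ | ⟨⟨ω₀⟩⟩
  · simp
  have hkn : k ≤ n := by
    rw [← hk ω₀, hn, ← Module.finrank_fintype_fun_eq_card F]
    exact Submodule.finrank_le _
  have hle : ∀ w w' : Fin s → ι → F, LinearIndependent F w → LinearIndependent F w' →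
      Nat.card {ω // ∀ j, w j ∈ c ω} ≤ Nat.card {ω // ∀ j, w' j ∈ c ω} := by
    intro w w' hw hw'
    obtain ⟨g, hgw⟩ := hw.exists_linearEquiv hw'
    obtain ⟨a, ha, hac⟩ := hg g
    refine Nat.card_le_card_of_injective (fun ω => ⟨a ω.1, fun j => ?_⟩) fun x y hxy =>
      Subtype.ext (ha (congrArg Subtype.val hxy))
    rw [hac, ← hgw]
    exact ⟨w j, ω.2 j, rfl⟩
  let L := {w : Fin s → ι → F // LinearIndependent F w}
  have : Fintype L := Fintype.ofFinite L
  have hcount : Nat.card L * Nat.card {ω // ∀ j, w j ∈ c ω} =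
      Nat.card Ω * ∏ i : Fin s, (q ^ k - q ^ (i : ℕ)) := by
    have e : (Σ w : L, {ω // ∀ j, w.1 j ∈ c ω}) ≃ Σ ω : Ω, {w : L // ∀ j, w.1 j ∈ c ω} :=
      ⟨fun x => ⟨x.2.1, x.1, x.2.2⟩, fun x => ⟨x.2.1, x.1, x.2.2⟩, fun _ => rfl, fun _ => rfl⟩
    have h := Nat.card_congr e
    rw [Nat.card_sigma, Nat.card_sigma] at h
    have h1 : ∀ w' : L, Nat.card {ω // ∀ j, w'.1 j ∈ c ω} = Nat.card {ω // ∀ j, w j ∈ c ω} :=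
      fun w' => le_antisymm (hle _ _ w'.2 hw) (hle _ _ hw w'.2)
    have h2 : ∀ ω, Nat.card {w : L // ∀ j, w.1 j ∈ c ω} = ∏ i : Fin s, (q ^ k - q ^ (i : ℕ)) :=
      fun ω => by
        rw [card_linearIndependent_mem (c ω) (by rw [hk]; exact hsk), hk]
    simp only [h1, h2, Finset.sum_const, Finset.card_univ, smul_eq_mul] at h
    rw [Nat.card_eq_fintype_card (α := L), Nat.card_eq_fintype_card (α := Ω)]
    exact h
  have hL : Nat.card L = ∏ i : Fin s, (q ^ n - q ^ (i : ℕ)) := by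
    have := card_linearIndependent (K := F) (V := ι → F) (k := s)
      (by rw [Module.finrank_fintype_fun_eq_card]; omega)
    rw [Module.finrank_fintype_fun_eq_card, ← Nat.card_eq_fintype_card (α := F)] at this
    exact this
  have hLpos : 0 < Nat.card L := by
    rw [hL]
    refine Finset.prod_pos fun i _ => Nat.sub_pos_of_lt (Nat.pow_lt_pow_right hq1 ?_)
    omega
  refine Nat.le_of_mul_le_mul_left ?_ hLpos
  calc Nat.card L * (Nat.card {ω // ∀ j, w j ∈ c ω} * q ^ ((n - k) * s))
      = Nat.card Ω * ((∏ i : Fin s, (q ^ k - q ^ (i : ℕ))) * ∏ _i : Fin s, q ^ (n - k)) := by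
        rw [← mul_assoc, hcount, Finset.prod_const, Finset.card_univ, Fintype.card_fin, ← pow_mul,
          mul_assoc]
    _ ≤ Nat.card Ω * Nat.card L := by
        rw [hL, ← Finset.prod_mul_distrib]
        refine Nat.mul_le_mul_left _ (Finset.prod_le_prod' fun i _ => ?_)
        rw [Nat.sub_mul, ← pow_add, Nat.add_sub_cancel' hkn]
        exact Nat.sub_le_sub_left (Nat.le_mul_of_pos_right _ (pow_pos (by omega) _)) _
    _ = Nat.card L * Nat.card Ω := mul_comm _ _

variable [DecidableEq F]

theorem IsSpread.card_meetsSparse_le [Finite F] {Ω : Type*} [Finite Ω]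
    {c : Ω → Submodule F (ι → F)} {d : ℕ} (hc : IsSpread c d) (m r t : ℕ) :
    Nat.card {ω // ∃ p, MeetsSparse m r t (c ω) p} * Nat.card F ^ (d * (r - t)) ≤
      Nat.card (SparseVec F ι m) ^ r * Nat.card F ^ (t * r) *
        Nat.card (SparseVec F ι m) ^ (r - t) * Nat.card Ω := by
  have h := Nat.card_exists_mul_le (fun p ω => MeetsSparse m r t (c ω) p)
    (a := Nat.card F ^ (d * (r - t))) (b := Nat.card Ω) fun p => by
      by_cases hp : LinearIndependent F (fun j =>
        (∑ i, (kerCode p.2.1).indepFamily (r - t) j i • (p.1 i : ι → F)) + p.2.2 j)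
      · refine le_trans (Nat.mul_le_mul_right _ ?_) (hc (r - t) _ hp)
        exact Nat.card_le_card_of_injective (fun ω => ⟨ω.1, ω.2.2⟩) fun x y h => by
          have h' := congrArg Subtype.val h
          exact Subtype.ext h'
      · have : IsEmpty {ω // MeetsSparse m r t (c ω) p} := ⟨fun ω => hp ω.2.1⟩
        simp
  refine h.trans_eq ?_
  rw [Nat.card_prod, Nat.card_prod, Nat.card_fun, Nat.card_fun, Matrix, Nat.card_fun, Nat.card_fun]
  simp only [Nat.card_eq_fintype_card, Fintype.card_fin]
  ring

/-- A union bound over the data `p`. With `C` fixed, `indepFamily` makes the tested vectors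
functions of `p` alone. -/
theorem IsSpread.card_meetsChecks_le [Finite F] {Ω : Type*} [Finite Ω]
    {c : Ω → Submodule F (ι → F)} {d : ℕ} (hc : IsSpread c d) (m r t : ℕ)
    (C : Submodule F (ι → F)) :
    Nat.card {ω // ∃ p, MeetsChecks m r t C (c ω) p} * Nat.card F ^ (d * (t + 1)) ≤
      Nat.card {S : Finset ι // S.card ≤ m} * (Nat.card (SparseVec F ι m) ^ r *
        (Fintype.card ι ^ r * (Nat.card (SparseVec F ι m) ^ r *
          Nat.card (SparseVec F ι m) ^ (t + 1)))) * Nat.card Ω := by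
  have h := Nat.card_exists_mul_le (fun p ω => MeetsChecks m r t C (c ω) p)
    (a := Nat.card F ^ (d * (t + 1))) (b := Nat.card Ω) fun p => by
      by_cases hp : LinearIndependent F (fun j =>
        (checkImage C p.1 (Matrix.ofRowsCols (fun k => (p.2.1 k : ι → F))
          p.2.2.1 fun k => (p.2.2.2.1 k : ι → F))).indepFamily (t + 1) j + p.2.2.2.2 j)
      · refine le_trans (Nat.mul_le_mul_right _ ?_) (hc (t + 1) _ hp)
        exact Nat.card_le_card_of_injective (fun ω => ⟨ω.1, ω.2.2⟩) fun x y h => by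
          have h' := congrArg Subtype.val h
          exact Subtype.ext h'
      · have : IsEmpty {ω // MeetsChecks m r t C (c ω) p} := ⟨fun ω => hp ω.2.1⟩
        simp
  refine h.trans_eq ?_
  rw [Nat.card_prod, Nat.card_prod, Nat.card_prod, Nat.card_prod, Nat.card_fun, Nat.card_fun,
    Nat.card_fun]
  simp only [Nat.card_eq_fintype_card (α := Fin _), Fintype.card_fin,
    Nat.card_eq_fintype_card (α := ι)]

theorem card_sparseVec_le [Finite F] (m : ℕ) :
    Nat.card (SparseVec F ι m) ≤ Nat.card {S : Finset ι // S.card ≤ m} * Nat.card F ^ m := by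
  classical
  have : Fintype F := Fintype.ofFinite F
  have hF : 0 < Nat.card F := Nat.card_pos
  have h := Nat.card_exists_mul_le
    (fun (S : {S : Finset ι // S.card ≤ m}) (v : ι → F) => v ∈ supportedOn F S.1)
    (a := 1) (b := Nat.card F ^ m) fun S => by
      rw [mul_one]
      calc Nat.card {v : ι → F // v ∈ supportedOn F S.1} ≤ Nat.card (S.1 → F) := by
            refine Nat.card_le_card_of_injective (fun v i => v.1 i) fun x y h => ?_
            refine Subtype.ext (funext fun i => ?_)
            by_cases hi : i ∈ S.1
            · exact congrFun h ⟨i, hi⟩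
            · rw [x.2 i hi, y.2 i hi]
        _ = Nat.card F ^ S.1.card := by
            rw [Nat.card_fun]
            simp
        _ ≤ Nat.card F ^ m := Nat.pow_le_pow_right hF S.2
  rw [mul_one] at h
  refine le_trans ?_ h
  refine Nat.card_le_card_of_injective (fun v => ⟨v.1, ⟨Finset.univ.filter (fun i => v.1 i ≠ 0),
    v.2⟩, fun i hi => ?_⟩) fun x y h => by
      have h' := congrArg Subtype.val h
      exact Subtype.ext h'
  by_contra h0
  exact hi (Finset.mem_filter.2 ⟨Finset.mem_univ _, h0⟩)

theorem card_finset_le_card_sparseVec [Finite F] (m : ℕ) :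
    Nat.card {S : Finset ι // S.card ≤ m} ≤ Nat.card (SparseVec F ι m) := by
  classical
  refine Nat.card_le_card_of_injective (fun S => ⟨fun i => if i ∈ S.1 then 1 else 0, ?_⟩) ?_
  · refine (hammingNorm_le_of_mem_supportedOn (S := S.1) fun i hi => if_neg hi).trans S.2
  · intro S T h
    refine Subtype.ext (Finset.ext fun i => ?_)
    have := congrFun (congrArg Subtype.val h) i
    by_cases hS : i ∈ S.1 <;> by_cases hT : i ∈ T.1 <;> simp_all

theorem card_le_card_sparseVec [Finite F] {m : ℕ} (hm : 1 ≤ m) :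
    Fintype.card ι ≤ Nat.card (SparseVec F ι m) := by
  rw [← Nat.card_eq_fintype_card]
  refine le_trans ?_ (card_finset_le_card_sparseVec m)
  exact Nat.card_le_card_of_injective (fun i => ⟨{i}, by simpa using hm⟩) fun i j h => by
    simpa using h

end Counting

/-! ### Numerical estimates for the union bounds -/

section Estimates

theorem Nat.card_exists_le {α Ω : Type*} [Finite α] [Finite Ω] (P : α → Ω → Prop) {b : ℝ}
    (h : ∀ i, (Nat.card {ω // P i ω} : ℝ) ≤ b) :
    (Nat.card {ω // ∃ i, P i ω} : ℝ) ≤ Nat.card α * b := by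
  have : Fintype α := Fintype.ofFinite α
  have h1 : Nat.card {ω // ∃ i, P i ω} ≤ Nat.card (Σ i, {ω // P i ω}) :=
    Nat.card_le_card_of_surjective
      (fun x : Σ i, {ω // P i ω} => (⟨x.2.1, x.1, x.2.2⟩ : {ω // ∃ i, P i ω}))
      fun ⟨ω, i, hi⟩ => ⟨⟨i, ω, hi⟩, rfl⟩
  rw [Nat.card_sigma] at h1
  calc (Nat.card {ω // ∃ i, P i ω} : ℝ) ≤ ((∑ i, Nat.card {ω // P i ω} : ℕ) : ℝ) := by
        exact_mod_cast h1
    _ = ∑ i, (Nat.card {ω // P i ω} : ℝ) := by push_cast; rfl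
    _ ≤ ∑ _i : α, b := Finset.sum_le_sum fun i _ => h i
    _ = Nat.card α * b := by simp

/-- Small Hamming balls have small exponential size. -/
theorem exists_card_finset_mul_pow_le {η : ℝ} (hη₀ : 0 < η) (hη₁ : η ≤ 1) :
    ∃ α : ℝ, 0 < α ∧ α ≤ 1 ∧ ∀ (ι : Type) [Fintype ι] (m q : ℕ), 2 ≤ q →
      (m : ℝ) ≤ α * Fintype.card ι →
      (Nat.card {S : Finset ι // S.card ≤ m} : ℝ) * (q : ℝ) ^ m ≤
        (q : ℝ) ^ (η * Fintype.card ι) := by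
  have hl2 : 0 < Real.log 2 := Real.log_pos one_lt_two
  have hl2' : Real.log 2 < 1 := Real.log_two_lt_d9.trans (by norm_num)
  -- Weighting each set by μ^|S| bounds their number by exp(2μn) = 2^(2ηn/3); the remaining third of
  -- the exponent pays for q^m.
  set μ := η * Real.log 2 / 3 with hμ
  have hμ₀ : 0 < μ := by positivity
  have hμ₁ : μ < 1 := by
    have : η * Real.log 2 ≤ 1 * 1 := by gcongr
    rw [hμ]
    linarith
  have hlog : Real.log μ < 0 := Real.log_neg hμ₀ hμ₁
  refine ⟨min (η / 3) (μ / -Real.log μ), lt_min (by positivity) (div_pos hμ₀ (by linarith)),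
    (min_le_left _ _).trans (by linarith), ?_⟩
  intro ι _ m q hq hm
  set n := Fintype.card ι with hn
  have hn0 : (0 : ℝ) ≤ n := Nat.cast_nonneg n
  have hm1 : (m : ℝ) ≤ η / 3 * n := hm.trans (by gcongr; exact min_le_left _ _)
  have hm2 : (m : ℝ) * -Real.log μ ≤ μ * n := by
    have h1 : (m : ℝ) ≤ μ / -Real.log μ * n := hm.trans (by gcongr; exact min_le_right _ _)
    have h2 : (0 : ℝ) < -Real.log μ := by linarith
    calc (m : ℝ) * -Real.log μ ≤ μ / -Real.log μ * n * -Real.log μ := by gcongr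
      _ = μ * n := by rw [mul_right_comm, div_mul_cancel₀ _ h2.ne']
  have hq1 : (1 : ℝ) ≤ q := by exact_mod_cast (by omega : 1 ≤ q)
  have hcount : (Nat.card {S : Finset ι // S.card ≤ m} : ℝ) * μ ^ m ≤ (1 + μ) ^ n := by
    classical
    rw [Nat.card_eq_fintype_card, Fintype.card_subtype]
    calc ((Finset.univ.filter fun S : Finset ι => S.card ≤ m).card : ℝ) * μ ^ m
        = ∑ S ∈ Finset.univ.filter fun S : Finset ι => S.card ≤ m, μ ^ m := by simp
      _ ≤ ∑ S ∈ Finset.univ.filter fun S : Finset ι => S.card ≤ m, μ ^ S.card :=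
          Finset.sum_le_sum fun S hS =>
            pow_le_pow_of_le_one hμ₀.le hμ₁.le (Finset.mem_filter.1 hS).2
      _ ≤ ∑ S : Finset ι, μ ^ S.card :=
          Finset.sum_le_sum_of_subset_of_nonneg (Finset.subset_univ _) fun _ _ _ => by positivity
      _ = (1 + μ) ^ n := by
          have := Fintype.sum_pow_mul_eq_add_pow ι μ 1
          simp only [one_pow, mul_one] at this
          rw [this, add_comm]
  have hexp : (1 + μ) ^ n ≤ Real.exp (μ * n) := by
    have h1 : 1 + μ ≤ Real.exp μ := by linarith [Real.add_one_le_exp μ]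
    calc (1 + μ) ^ n ≤ Real.exp μ ^ n := by gcongr
      _ = Real.exp (μ * n) := by rw [← Real.exp_nat_mul, mul_comm]
  have hμm : Real.exp (-(μ * n)) ≤ μ ^ m := by
    calc Real.exp (-(μ * n)) ≤ Real.exp (m * Real.log μ) := by
          apply Real.exp_le_exp.2
          linarith
      _ = μ ^ m := by rw [Real.exp_nat_mul, Real.exp_log hμ₀]
  have hcard : (Nat.card {S : Finset ι // S.card ≤ m} : ℝ) ≤ Real.exp (2 * (μ * n)) := by
    have h1 : (Nat.card {S : Finset ι // S.card ≤ m} : ℝ) * Real.exp (-(μ * n)) ≤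
        Real.exp (μ * n) :=
      (mul_le_mul_of_nonneg_left hμm (Nat.cast_nonneg _)).trans (hcount.trans hexp)
    calc (Nat.card {S : Finset ι // S.card ≤ m} : ℝ)
        = Nat.card {S : Finset ι // S.card ≤ m} * Real.exp (-(μ * n)) * Real.exp (μ * n) := by
          rw [mul_assoc, ← Real.exp_add, neg_add_cancel, Real.exp_zero, mul_one]
      _ ≤ Real.exp (μ * n) * Real.exp (μ * n) := by gcongr
      _ = Real.exp (2 * (μ * n)) := by rw [← Real.exp_add, two_mul]
  have hcard' : Real.exp (2 * (μ * n)) ≤ (q : ℝ) ^ (2 * η / 3 * n) := by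
    rw [Real.rpow_def_of_pos (by linarith)]
    apply Real.exp_le_exp.2
    have h1 : Real.log 2 ≤ Real.log q := Real.log_le_log two_pos (by exact_mod_cast hq)
    calc 2 * (μ * n) = Real.log 2 * (2 * η / 3 * n) := by rw [hμ]; ring
      _ ≤ Real.log q * (2 * η / 3 * n) := by gcongr
  have hpow : (q : ℝ) ^ m ≤ (q : ℝ) ^ (η / 3 * n) := by
    rw [← Real.rpow_natCast]
    exact Real.rpow_le_rpow_of_exponent_le hq1 hm1
  calc (Nat.card {S : Finset ι // S.card ≤ m} : ℝ) * (q : ℝ) ^ m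
      ≤ (q : ℝ) ^ (2 * η / 3 * n) * (q : ℝ) ^ (η / 3 * n) := by
        gcongr
        exact hcard.trans hcard'
    _ = (q : ℝ) ^ (η * n) := by
        rw [← Real.rpow_add (by linarith)]
        congr 1
        ring

/-- If `x ≤ q ^ a` and `a + c ≤ b`, then `x ≤ 2 ^ (-c) q ^ b`. -/
theorem le_two_rpow_mul_pow {q : ℕ} (hq : 2 ≤ q) {x a c : ℝ} {b : ℕ} (hx : x ≤ (q : ℝ) ^ a)
    (hc : 0 ≤ c) (h : a + c ≤ b) : x ≤ (2 : ℝ) ^ (-c) * (q : ℝ) ^ b := by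
  have hq1 : (1 : ℝ) ≤ q := by exact_mod_cast (by omega : 1 ≤ q)
  have hq2 : (2 : ℝ) ≤ q := by exact_mod_cast hq
  calc x ≤ (q : ℝ) ^ a := hx
    _ ≤ (q : ℝ) ^ (-c + b) := Real.rpow_le_rpow_of_exponent_le hq1 (by linarith)
    _ = (q : ℝ) ^ (-c) * (q : ℝ) ^ b := by rw [Real.rpow_add (by linarith), Real.rpow_natCast]
    _ ≤ (2 : ℝ) ^ (-c) * (q : ℝ) ^ b := by
        gcongr ?_ * _
        exact Real.rpow_le_rpow_of_nonpos two_pos hq2 (by linarith)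

variable {q N n d r : ℕ} {δ : ℝ}

/-- The matrix `K` costs tr ≤ δnr/4 in the exponent and the sparse vectors cost O(δ²nr), against a
gain of at least δ(1 − δ/4)nr. -/
theorem sparse_count_le (hq : 2 ≤ q) (hδ₀ : 0 < δ) (hδ₁ : δ ≤ 1 / 2)
    (hN : (N : ℝ) ≤ (q : ℝ) ^ (δ ^ 2 / 40 * n)) (hd : δ * n ≤ d) (hr : 1 ≤ r) (hrn : r ≤ n) :
    (N : ℝ) ^ r * (q : ℝ) ^ (⌊δ * r / 4⌋₊ * r) * (N : ℝ) ^ (r - ⌊δ * r / 4⌋₊) ≤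
      (2 : ℝ) ^ (-(δ ^ 2 / 16 * n)) * (q : ℝ) ^ (d * (r - ⌊δ * r / 4⌋₊)) := by
  set t := ⌊δ * r / 4⌋₊ with ht
  have hr1 : (1 : ℝ) ≤ r := by exact_mod_cast hr
  have hrn' : (r : ℝ) ≤ n := by exact_mod_cast hrn
  have ht1 : (t : ℝ) ≤ δ * r / 4 := Nat.floor_le (by positivity)
  have htr : t ≤ r := by
    have : (t : ℝ) ≤ r := ht1.trans (by nlinarith)
    exact_mod_cast this
  have hq0 : (0 : ℝ) < q := by exact_mod_cast (by omega : 0 < q)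
  have hNp : ∀ k : ℕ, (N : ℝ) ^ k ≤ (q : ℝ) ^ (δ ^ 2 / 40 * n * k) := fun k => by
    rw [Real.rpow_mul hq0.le, Real.rpow_natCast]
    gcongr
  refine le_two_rpow_mul_pow (a := δ ^ 2 / 40 * n * r + (t * r : ℕ) +
    δ ^ 2 / 40 * n * (r - t : ℕ)) hq ?_ (by positivity) ?_
  · rw [Real.rpow_add hq0, Real.rpow_add hq0, Real.rpow_natCast]
    gcongr
    · exact hNp r
    · exact hNp (r - t)
  · push_cast [Nat.cast_sub htr]
    have e1 : δ ^ 2 / 40 * n * (r - t) ≤ δ ^ 2 / 40 * n * r := by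
      gcongr
      linarith [(Nat.cast_nonneg t : (0 : ℝ) ≤ t)]
    have e2 : (t : ℝ) * r ≤ δ / 4 * (n * r) := by
      calc (t : ℝ) * r ≤ δ * r / 4 * r := by gcongr
        _ ≤ δ * n / 4 * r := by gcongr
        _ = _ := by ring
    have e3 : δ ^ 2 / 16 * n ≤ δ ^ 2 / 16 * (n * r) := by
      gcongr
      exact le_mul_of_one_le_right (by positivity) hr1
    have e4 : δ * (1 - δ / 4) * (n * r) ≤ d * (r - t) := by
      calc δ * (1 - δ / 4) * (n * r) = δ * n * (r - δ * r / 4) := by ring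
        _ ≤ d * (r - t) := by
          gcongr
          nlinarith
    have e5 : δ ^ 2 * (n * r) ≤ δ / 2 * (n * r) := by
      gcongr
      nlinarith
    have e6 : 0 ≤ δ * ((n : ℝ) * r) := by positivity
    nlinarith

/-- At most 3r + t + 2 ≤ 6r factors `N` cost 6δ²nr/40, against a gain of at least δ²nr/4 since t + 1
≥ δr/4. -/
theorem check_count_le {B : ℝ} (hq : 2 ≤ q) (hδ₀ : 0 < δ) (hδ₁ : δ ≤ 1 / 2)
    (hN : (N : ℝ) ≤ (q : ℝ) ^ (δ ^ 2 / 40 * n)) (hB : B ≤ N) (hnN : n ≤ N)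
    (hd : δ * n ≤ d) (hr : 1 ≤ r) :
    B * ((N : ℝ) ^ r * ((n : ℝ) ^ r * ((N : ℝ) ^ r * (N : ℝ) ^ (⌊δ * r / 4⌋₊ + 1)))) ≤
      (2 : ℝ) ^ (-(δ ^ 2 / 16 * n)) * (q : ℝ) ^ (d * (⌊δ * r / 4⌋₊ + 1)) := by
  set t := ⌊δ * r / 4⌋₊ with ht
  have hr1 : (1 : ℝ) ≤ r := by exact_mod_cast hr
  have ht1 : (t : ℝ) ≤ δ * r / 4 := Nat.floor_le (by positivity)
  have ht2 : δ * r / 4 ≤ t + 1 := (Nat.lt_floor_add_one _).le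
  have hq0 : (0 : ℝ) < q := by exact_mod_cast (by omega : 0 < q)
  have hnN' : (n : ℝ) ≤ N := by exact_mod_cast hnN
  refine le_two_rpow_mul_pow (a := δ ^ 2 / 40 * n * (3 * r + t + 2 : ℕ)) hq ?_ (by positivity) ?_
  · calc B * ((N : ℝ) ^ r * ((n : ℝ) ^ r * ((N : ℝ) ^ r * (N : ℝ) ^ (t + 1))))
        ≤ N * ((N : ℝ) ^ r * ((N : ℝ) ^ r * ((N : ℝ) ^ r * (N : ℝ) ^ (t + 1)))) := by gcongr
      _ = (N : ℝ) ^ (3 * r + t + 2) := by ring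
      _ ≤ (q : ℝ) ^ (δ ^ 2 / 40 * n * (3 * r + t + 2 : ℕ)) := by
        rw [Real.rpow_mul hq0.le, Real.rpow_natCast]
        gcongr
  · push_cast
    have e1 : (3 * r + t + 2 : ℝ) ≤ 6 * r := by nlinarith
    have e2 : δ ^ 2 / 40 * n * (3 * r + t + 2) ≤ δ ^ 2 / 40 * n * (6 * r) := by gcongr
    have e3 : δ ^ 2 / 16 * n ≤ δ ^ 2 / 16 * (n * r) := by
      gcongr
      exact le_mul_of_one_le_right (by positivity) hr1
    have e4 : δ * n * (δ * r / 4) ≤ d * (t + 1) := by gcongr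
    have e6 : 0 ≤ δ ^ 2 * ((n : ℝ) * r) := by positivity
    nlinarith

end Estimates

/-! ### Random pairs of codes are good -/

section RandomPairs

variable {F : Type*} [Field F] [DecidableEq F] [Finite F] {ι : Type*} [Fintype ι]

theorem card_not_isPairGood_le {Ω₁ Ω₂ : Type*} [Finite Ω₁] [Finite Ω₂]
    {c₁ : Ω₁ → Submodule F (ι → F)} {c₂ : Ω₂ → Submodule F (ι → F)} {d₁ d₂ m : ℕ} {δ : ℝ}
    (hc₁ : IsSpread c₁ d₁) (hc₂ : IsSpread c₂ d₂) (hδ₀ : 0 < δ) (hδ₁ : δ ≤ 1 / 2)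
    (hd₁ : δ * Fintype.card ι ≤ d₁) (hd₂ : δ * Fintype.card ι ≤ d₂) (hm : 1 ≤ m)
    (hN : (Nat.card (SparseVec F ι m) : ℝ) ≤
      (Nat.card F : ℝ) ^ (δ ^ 2 / 40 * Fintype.card ι)) :
    (Nat.card {x : Ω₁ × Ω₂ // ¬ IsPairGood m (c₁ x.1) (c₂ x.2)} : ℝ) ≤
      2 * Fintype.card ι * (2 : ℝ) ^ (-(δ ^ 2 / 16 * Fintype.card ι)) *
        (Nat.card Ω₁ * Nat.card Ω₂) := by
  set n := Fintype.card ι with hn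
  set q := Nat.card F with hq
  set N := Nat.card (SparseVec F ι m) with hNdef
  set β : ℝ := (2 : ℝ) ^ (-(δ ^ 2 / 16 * n)) with hβ
  have hq2 : 2 ≤ q := Finite.one_lt_card
  have hq0 : (0 : ℝ) < q := by exact_mod_cast (by omega : 0 < q)
  let t : ℕ → ℕ := fun r => ⌊δ * r / 4⌋₊
  have hA : ∀ r, 1 ≤ r → r ≤ n →
      (Nat.card {ω // ∃ p, MeetsSparse m r (t r) (c₁ ω) p} : ℝ) ≤ β * Nat.card Ω₁ := by
    intro r hr hrn
    have h1 := hc₁.card_meetsSparse_le m r (t r)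
    have h2 := sparse_count_le hq2 hδ₀ hδ₁ hN hd₁ hr hrn
    have h3 : (Nat.card {ω // ∃ p, MeetsSparse m r (t r) (c₁ ω) p} : ℝ) * q ^ (d₁ * (r - t r)) ≤
        N ^ r * q ^ (t r * r) * N ^ (r - t r) * Nat.card Ω₁ := by exact_mod_cast h1
    refine le_of_mul_le_mul_right (h3.trans ?_) (pow_pos hq0 (d₁ * (r - t r)))
    calc (N : ℝ) ^ r * q ^ (t r * r) * N ^ (r - t r) * Nat.card Ω₁
        ≤ β * q ^ (d₁ * (r - t r)) * Nat.card Ω₁ := by gcongr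
      _ = _ := by ring
  have hB : ∀ r, 1 ≤ r → ∀ C, (Nat.card {ω // ∃ p, MeetsChecks m r (t r) C (c₂ ω) p} : ℝ) ≤
      β * Nat.card Ω₂ := by
    intro r hr C
    have h1 := hc₂.card_meetsChecks_le m r (t r) C
    have h2 := check_count_le (B := Nat.card {S : Finset ι // S.card ≤ m}) hq2 hδ₀ hδ₁ hN
      (by exact_mod_cast card_finset_le_card_sparseVec m)
      (card_le_card_sparseVec hm) hd₂ hr
    have h3 : (Nat.card {ω // ∃ p, MeetsChecks m r (t r) C (c₂ ω) p} : ℝ) *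
        q ^ (d₂ * (t r + 1)) ≤ Nat.card {S : Finset ι // S.card ≤ m} * (N ^ r *
          (n ^ r * (N ^ r * N ^ (t r + 1)))) * Nat.card Ω₂ := by exact_mod_cast h1
    refine le_of_mul_le_mul_right (h3.trans ?_) (pow_pos hq0 (d₂ * (t r + 1)))
    calc _ ≤ β * q ^ (d₂ * (t r + 1)) * Nat.card Ω₂ := by gcongr
      _ = _ := by ring
  -- One event of each kind for every rank `i + 1`, whence the factor 2n.
  let P : Fin n × Bool → Ω₁ × Ω₂ → Prop := fun i x =>
    if i.2 then ∃ p, MeetsSparse m (i.1 + 1) (t (i.1 + 1)) (c₁ x.1) p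
    else ∃ p, MeetsChecks m (i.1 + 1) (t (i.1 + 1)) (c₁ x.1) (c₂ x.2) p
  have hP := Nat.card_exists_le P (b := β * (Nat.card Ω₁ * Nat.card Ω₂)) fun ⟨i, b⟩ => by
    cases b
    -- Independence enters here: condition on the first code and use the randomness of the second.
    · have : Fintype Ω₁ := Fintype.ofFinite Ω₁
      let e : {x : Ω₁ × Ω₂ // P (i, false) x} ≃
          Σ ω : Ω₁, {ω' // ∃ p, MeetsChecks m (i + 1) (t (i + 1)) (c₁ ω) (c₂ ω') p} :=
        ⟨fun x => ⟨x.1.1, x.1.2, x.2⟩, fun x => ⟨(x.1, x.2.1), x.2.2⟩, fun _ => rfl,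
          fun _ => rfl⟩
      rw [Nat.card_congr e, Nat.card_sigma, Nat.cast_sum]
      refine (Finset.sum_le_sum fun ω _ => hB (i + 1) (by omega) (c₁ ω)).trans_eq ?_
      rw [Finset.sum_const, Finset.card_univ, nsmul_eq_mul, Nat.card_eq_fintype_card (α := Ω₁)]
      ring
    · let e : {x : Ω₁ × Ω₂ // P (i, true) x} ≃
          {ω // ∃ p, MeetsSparse m (i + 1) (t (i + 1)) (c₁ ω) p} × Ω₂ :=
        ⟨fun x => (⟨x.1.1, x.2⟩, x.1.2), fun x => ⟨(x.1.1, x.2), x.1.2⟩, fun _ => rfl,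
          fun _ => rfl⟩
      rw [Nat.card_congr e, Nat.card_prod, Nat.cast_mul, ← mul_assoc]
      gcongr
      exact hA (i + 1) (by omega) (by omega)
  have hle : Nat.card {x : Ω₁ × Ω₂ // ¬ IsPairGood m (c₁ x.1) (c₂ x.2)} ≤
      Nat.card {x // ∃ i, P i x} := by
    refine Nat.card_le_card_of_injective (Subtype.map id fun x hx => ?_)
      (Subtype.map_injective _ Function.injective_id)
    obtain ⟨r, hr, hrn, h | h⟩ := exists_meets_of_not_isPairGood t hx
    · obtain ⟨r, rfl⟩ := Nat.exists_eq_add_of_le' hr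
      exact ⟨(⟨r, by omega⟩, true), h⟩
    · obtain ⟨r, rfl⟩ := Nat.exists_eq_add_of_le' hr
      exact ⟨(⟨r, by omega⟩, false), h⟩
  calc (Nat.card {x : Ω₁ × Ω₂ // ¬ IsPairGood m (c₁ x.1) (c₂ x.2)} : ℝ)
      ≤ Nat.card {x // ∃ i, P i x} := by exact_mod_cast hle
    _ ≤ _ := hP
    _ = _ := by
      simp only [Nat.card_eq_fintype_card, Fintype.card_prod, Fintype.card_fin, Fintype.card_bool]
      push_cast
      ring

end RandomPairs

/-! ### Linear symmetries of CSS codes -/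

namespace CSSCode

variable {F : Type*} [Field F] {ι : Type*} [Fintype ι]

theorem ext_codes {Q Q' : CSSCode F ι} (hX : Q.QX = Q'.QX) (hZ : Q.QZ = Q'.QZ) : Q = Q' := by
  cases Q
  cases Q'
  cases hX
  cases hZ
  rfl

/-- The action of a linear automorphism on CSS codes, covariant on `Q_Z` and contravariant on
`Q_X`. -/
def map (g : (ι → F) ≃ₗ[F] (ι → F)) (Q : CSSCode F ι) : CSSCode F ι where
  QX := dualCode ((dualCode Q.QX).map g.toLinearMap)
  QZ := Q.QZ.map g.toLinearMap
  css := by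
    rw [dualCode_dualCode]
    exact Submodule.map_mono Q.css

theorem map_injective (g : (ι → F) ≃ₗ[F] (ι → F)) : Function.Injective (map g) := by
  intro Q Q' h
  have hmap := Submodule.map_injective_of_injective (f := g.toLinearMap) g.injective
  have hdual : Function.Injective (dualCode (F := F) (ι := ι)) := fun C D h => by
    rw [← dualCode_dualCode C, h, dualCode_dualCode]
  exact ext_codes (hdual (hmap (hdual (congrArg QX h)))) (hmap (congrArg QZ h))

theorem finrank_dualCode_map_dualCode (g : (ι → F) ≃ₗ[F] (ι → F)) (C : Submodule F (ι → F)) :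
    Module.finrank F (dualCode ((dualCode C).map g.toLinearMap)) = Module.finrank F C := by
  have h := Submodule.finrank_le C
  rw [Module.finrank_fintype_fun_eq_card] at h
  rw [finrank_dualCode, LinearEquiv.finrank_map_eq, finrank_dualCode]
  omega

theorem dim_map (g : (ι → F) ≃ₗ[F] (ι → F)) (Q : CSSCode F ι) : (Q.map g).dim = Q.dim := by
  have hX : dualCode (Q.map g).QX = (dualCode Q.QX).map g.toLinearMap := dualCode_dualCode _
  have hZ : (Q.map g).QZ = Q.QZ.map g.toLinearMap := rfl
  rw [dim, dim, hX, hZ, LinearEquiv.finrank_map_eq, LinearEquiv.finrank_map_eq]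

/-- The CSS code with the two sectors exchanged. -/
def swap (Q : CSSCode F ι) : CSSCode F ι where
  QX := Q.QZ
  QZ := Q.QX
  css := by
    rw [← dualCode_dualCode Q.QX]
    exact dualCode_anti Q.css

end CSSCode

/-! ### Balanced CSS codes of fixed rate -/

section Balanced

variable {F : Type*} [Field F] {n : ℕ} {R : ℝ}

theorem map_mem_balancedCSSCodes (g : (Fin n → F) ≃ₗ[F] (Fin n → F)) {Q : CSSCode F (Fin n)}
    (hQ : Q ∈ balancedCSSCodes F n R) : Q.map g ∈ balancedCSSCodes F n R := by
  refine ⟨?_, ?_⟩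
  · have hX : (Q.map g).QX = dualCode ((dualCode Q.QX).map g.toLinearMap) := rfl
    have hZ : (Q.map g).QZ = Q.QZ.map g.toLinearMap := rfl
    rw [hX, hZ, CSSCode.finrank_dualCode_map_dualCode, LinearEquiv.finrank_map_eq]
    exact hQ.1
  · rw [CSSCode.rate, CSSCode.dim_map]
    exact hQ.2

theorem swap_mem_balancedCSSCodes {Q : CSSCode F (Fin n)} (hQ : Q ∈ balancedCSSCodes F n R) :
    Q.swap ∈ balancedCSSCodes F n R := by
  refine ⟨hQ.1.symm, ?_⟩
  have hX : Q.swap.QX = Q.QZ := rfl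
  have hZ : Q.swap.QZ = Q.QX := rfl
  rw [← hQ.2, CSSCode.rate, CSSCode.rate, CSSCode.dim, CSSCode.dim, hX, hZ, finrank_dualCode,
    finrank_dualCode, hQ.1]

theorem two_mul_finrank_QZ (hn : 0 < n) {Q : CSSCode F (Fin n)}
    (hQ : Q ∈ balancedCSSCodes F n R) : (2 * Module.finrank F Q.QZ : ℝ) = (1 + R) * n := by
  have h1 := Submodule.finrank_mono Q.css
  have h2 := Submodule.finrank_le Q.QZ
  have h3 := hQ.2
  rw [finrank_dualCode, hQ.1, Fintype.card_fin] at h1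
  rw [Module.finrank_fin_fun] at h2
  rw [CSSCode.rate, CSSCode.dim, finrank_dualCode, hQ.1, Fintype.card_fin, Nat.cast_sub h1,
    Nat.cast_sub h2, div_eq_iff (by positivity)] at h3
  linarith

/-- The linear group acts on the balanced codes, which gives spread for `QZ`; exchanging the sectors
transfers it to `QX`. The codimension is (1 − R)n/2 ≥ εn/2. -/
theorem exists_isSpread_balancedCSSCodes [Finite F] (hn : 0 < n) {ε : ℝ} (hR : R ≤ 1 - ε)
    (hne : (balancedCSSCodes F n R).Nonempty) :
    ∃ d : ℕ, ε / 2 * n ≤ d ∧ IsSpread (fun Q : balancedCSSCodes F n R => Q.1.QZ) d ∧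
      IsSpread (fun Q : balancedCSSCodes F n R => Q.1.QX) d := by
  obtain ⟨Q₀, hQ₀⟩ := hne
  have hle := Submodule.finrank_le Q₀.QZ
  rw [Module.finrank_fin_fun] at hle
  have hZ : IsSpread (fun Q : balancedCSSCodes F n R => Q.1.QZ)
      (n - Module.finrank F Q₀.QZ) := by
    have := isSpread_of_linearEquiv (c := fun Q : balancedCSSCodes F n R => Q.1.QZ)
      (k := Module.finrank F Q₀.QZ) (fun Q => ?_) fun g => ⟨fun Q => ⟨Q.1.map g,
        map_mem_balancedCSSCodes g Q.2⟩, fun Q Q' h => ?_, fun Q => rfl⟩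
    · rwa [Fintype.card_fin] at this
    · have h1 := two_mul_finrank_QZ hn Q.2
      rw [← two_mul_finrank_QZ hn hQ₀] at h1
      have h2 : (Module.finrank F Q.1.QZ : ℝ) = Module.finrank F Q₀.QZ := by linarith
      exact_mod_cast h2
    · have h' := congrArg Subtype.val h
      exact Subtype.ext (CSSCode.map_injective g h')
  refine ⟨n - Module.finrank F Q₀.QZ, ?_, hZ, ?_⟩
  · rw [Nat.cast_sub hle]
    have h1 := two_mul_finrank_QZ hn hQ₀
    have h2 : (1 + R) * n ≤ (2 - ε) * n := by
      gcongr
      linarith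
    linarith
  · intro s w hw
    refine le_trans (Nat.mul_le_mul_right _ ?_) (hZ s w hw)
    refine Nat.card_le_card_of_injective
      (fun Q => ⟨⟨Q.1.1.swap, swap_mem_balancedCSSCodes Q.1.2⟩, Q.2⟩) fun Q Q' h => ?_
    have h' := congrArg (fun Q => Q.1.1) h
    exact Subtype.ext (Subtype.ext (CSSCode.ext_codes (congrArg CSSCode.QZ h')
      (congrArg CSSCode.QX h')))

end Balanced

/-! ### From counting to probability, and conclusion -/

theorem le_uniformProb {α : Type*} [Finite α] {S : Set α} (hS : S.Nonempty) {P : α → Prop}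
    {bad : S → Prop} {b : ℝ} (hP : ∀ x : S, ¬ bad x → P x)
    (hbad : (Nat.card {x // bad x} : ℝ) ≤ b * S.ncard) : 1 - b ≤ uniformProb S P := by
  have hpos : (0 : ℝ) < S.ncard := by
    exact_mod_cast (Set.ncard_pos (Set.toFinite S)).2 hS
  rw [uniformProb, le_div_iff₀ hpos]
  have h1 : S.ncard = {x ∈ S | P x}.ncard + {x ∈ S | ¬ P x}.ncard := by
    rw [← Set.ncard_union_eq]
    · congr 1
      ext x
      by_cases h : P x <;> simp [h]
    · rw [Set.disjoint_left]
      exact fun x hx hx' => hx'.2 hx.2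
  have h2 : {x ∈ S | ¬ P x}.ncard ≤ Nat.card {x // bad x} := by
    rw [← Nat.card_coe_set_eq]
    refine Nat.card_le_card_of_injective
      (fun x => ⟨⟨x.1, x.2.1⟩, by_contra fun h => x.2.2 (hP ⟨x.1, x.2.1⟩ h)⟩) fun x y h => ?_
    have h' := congrArg (fun x => x.1.1) h
    exact Subtype.ext h'
  have h3 : ({x ∈ S | ¬ P x}.ncard : ℝ) ≤ b * S.ncard := le_trans (by exact_mod_cast h2) hbad
  have h4 : (S.ncard : ℝ) = {x ∈ S | P x}.ncard + {x ∈ S | ¬ P x}.ncard := by exact_mod_cast h1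
  linarith

theorem tendsto_one_sub_mul_two_rpow {c : ℝ} (hc : 0 < c) :
    Tendsto (fun n : ℕ => 1 - 4 * n * (2 : ℝ) ^ (-(c * n))) atTop (𝓝 1) := by
  have h1 : ∀ n : ℕ, (2 : ℝ) ^ (-(c * n)) = ((2 : ℝ) ^ (-c)) ^ n := fun n => by
    rw [← Real.rpow_natCast, ← Real.rpow_mul two_pos.le, neg_mul]
  have h2 := tendsto_self_mul_const_pow_of_lt_one (r := (2 : ℝ) ^ (-c)) (by positivity)
    (Real.rpow_lt_one_of_one_lt_of_neg one_lt_two (by linarith))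
  have h3 := (h2.const_mul 4).const_sub 1
  rw [mul_zero, sub_zero] at h3
  refine h3.congr fun n => ?_
  rw [h1, mul_assoc]

theorem uniformProb_nonneg {α : Type*} [Finite α] (S : Set α) (P : α → Prop) :
    0 ≤ uniformProb S P := by
  unfold uniformProb
  positivity

/-- The X and Z pairs each fail in proportion at most 2n·2^(−δ²n/16). Only a union bound is taken,
so correlation between the two sectors of a code is harmless. -/
theorem le_uniformProb_isPairGood {F : Type*} [Field F] [Finite F] [DecidableEq F] {n m : ℕ}
    {R₁ R₂ ε δ : ℝ} (hn : 0 < n) (hm : 1 ≤ m) (hδ₀ : 0 < δ) (hδ₁ : δ ≤ 1 / 2)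
    (hδε : δ ≤ ε / 2) (hR₁ : R₁ ≤ 1 - ε) (hR₂ : R₂ ≤ 1 - ε)
    (hne₁ : (balancedCSSCodes F n R₁).Nonempty) (hne₂ : (balancedCSSCodes F n R₂).Nonempty)
    (hN : (Nat.card (SparseVec F (Fin n) m) : ℝ) ≤ (Nat.card F : ℝ) ^ (δ ^ 2 / 40 * n))
    {P : CSSCode F (Fin n) × CSSCode F (Fin n) → Prop}
    (hP : ∀ Q₁ ∈ balancedCSSCodes F n R₁, ∀ Q₂ ∈ balancedCSSCodes F n R₂,
      IsPairGood m Q₁.QX Q₂.QX → IsPairGood m Q₁.QZ Q₂.QZ → P (Q₁, Q₂)) :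
    1 - 4 * n * (2 : ℝ) ^ (-(δ ^ 2 / 16 * n)) ≤
      uniformProb (balancedCSSCodes F n R₁ ×ˢ balancedCSSCodes F n R₂) P := by
  obtain ⟨d₁, hd₁, hZ₁, hX₁⟩ := exists_isSpread_balancedCSSCodes hn hR₁ hne₁
  obtain ⟨d₂, hd₂, hZ₂, hX₂⟩ := exists_isSpread_balancedCSSCodes hn hR₂ hne₂
  have hd₁' : δ * n ≤ d₁ := le_trans (by gcongr) hd₁
  have hd₂' : δ * n ≤ d₂ := le_trans (by gcongr) hd₂
  set Ω₁ := balancedCSSCodes F n R₁ with hΩ₁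
  set Ω₂ := balancedCSSCodes F n R₂ with hΩ₂
  have hX := card_not_isPairGood_le (m := m) hX₁ hX₂ hδ₀ hδ₁ (by rwa [Fintype.card_fin])
    (by rwa [Fintype.card_fin]) hm (by rwa [Fintype.card_fin])
  have hZ := card_not_isPairGood_le (m := m) hZ₁ hZ₂ hδ₀ hδ₁ (by rwa [Fintype.card_fin])
    (by rwa [Fintype.card_fin]) hm (by rwa [Fintype.card_fin])
  rw [Fintype.card_fin] at hX hZ
  let bad : Bool → Ω₁ × Ω₂ → Prop := fun b x =>
    if b then ¬ IsPairGood m x.1.1.QX x.2.1.QX else ¬ IsPairGood m x.1.1.QZ x.2.1.QZ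
  have hbad := Nat.card_exists_le bad (b := 2 * n * (2 : ℝ) ^ (-(δ ^ 2 / 16 * n)) *
    (Nat.card Ω₁ * Nat.card Ω₂)) fun b => by
      cases b
      · exact hZ
      · exact hX
  let e := Equiv.Set.prod Ω₁ Ω₂
  refine le_uniformProb (hne₁.prod hne₂) (bad := fun x => ∃ b, bad b (e x)) ?_ ?_
  · intro x hx
    rw [not_exists] at hx
    exact hP x.1.1 x.2.1 x.1.2 x.2.2 (not_not.1 (hx true)) (not_not.1 (hx false))
  · have h1 : Nat.card {x // ∃ b, bad b (e x)} = Nat.card {x // ∃ b, bad b x} :=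
      Nat.card_congr (e.subtypeEquiv fun _ => Iff.rfl)
    rw [h1, Set.ncard_prod, ← Nat.card_coe_set_eq, ← Nat.card_coe_set_eq]
    refine hbad.trans_eq ?_
    rw [Nat.card_eq_fintype_card (α := Bool), Fintype.card_bool]
    push_cast
    ring

theorem corollary4p3 (ε : ℝ) (hε : 0 < ε) :
    ∃ Δ : ℝ, 0 < Δ ∧ ∃ ρ : ℝ, 0 < ρ ∧
    ∃ p : ℕ → ℝ, Tendsto p atTop (𝓝 1) ∧
    ∀ (n : ℕ) (F : Type*) [Field F] [Finite F] [CharP F 2] [DecidableEq F] (R₁ R₂ : ℝ),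
      R₁ ≤ 1 - ε → R₂ ≤ 1 - ε →
      (balancedCSSCodes F n R₁).Nonempty → (balancedCSSCodes F n R₂).Nonempty →
      p n ≤ uniformProb (balancedCSSCodes F n R₁ ×ˢ balancedCSSCodes F n R₂) (fun Q =>
        ∀ (r₁ r₂ : ℕ) (HX₁ HZ₁ : Matrix (Fin r₁) (Fin n) F) (HX₂ HZ₂ : Matrix (Fin r₂) (Fin n) F)
          (hX₁ : IsFullRankParityCheck HX₁ Q.1.QX) (hZ₁ : IsFullRankParityCheck HZ₁ Q.1.QZ)
          (hX₂ : IsFullRankParityCheck HX₂ Q.2.QX) (hZ₂ : IsFullRankParityCheck HZ₂ Q.2.QZ),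
          let A : SSComplex F (Fin n × Fin n) :=
            (SSComplex.ofCSS Q.1 HX₁ HZ₁ hX₁ hZ₁).prod (SSComplex.ofCSS Q.2 HX₂ HZ₂ hX₂ hZ₂)
          A.toCSS.HasParams (n ^ 2) (R₁ * R₂ * (n : ℝ) ^ 2) (Δ * (n : ℝ) ^ 2) ∧
          A.toCSS.IsLTC (2 * n) ρ ∧
          IsTester A.bdᵀ A.toCSS.QX (2 * n) ρ ∧ IsTester A.bd A.toCSS.QZ (2 * n) ρ) := by
  obtain ⟨δ, hδ₀, hδ₁, hδε⟩ : ∃ δ : ℝ, 0 < δ ∧ δ ≤ 1 / 2 ∧ δ ≤ ε / 2 :=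
    ⟨min (1 / 2) (ε / 2), lt_min (by norm_num) (by linarith), min_le_left _ _, min_le_right _ _⟩
  obtain ⟨α, hα₀, hα₁, hα⟩ := exists_card_finset_mul_pow_le (η := δ ^ 2 / 40) (by positivity)
    (by nlinarith)
  have hρ₁ : α ^ 2 / 2 ≤ 1 := by nlinarith
  -- One constant serves as Δ and ρ: with m = ⌊αn⌋ ≥ 1, m(m+1) ≥ (αn)²/2. If αn < 1 then m = 0 and
  -- expansion says nothing, so p(n) = 0 there.
  refine ⟨α ^ 2 / 2, by positivity, α ^ 2 / 2, by positivity,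
    fun n => if α * n < 1 then 0 else 1 - 4 * n * (2 : ℝ) ^ (-(δ ^ 2 / 16 * n)), ?_, ?_⟩
  · refine (tendsto_one_sub_mul_two_rpow (c := δ ^ 2 / 16) (by positivity)).congr' ?_
    have h1 : Tendsto (fun n : ℕ => α * (n : ℝ)) atTop atTop :=
      tendsto_natCast_atTop_atTop.const_mul_atTop hα₀
    filter_upwards [h1.eventually_ge_atTop 1] with n hn
    rw [if_neg (not_lt.2 hn)]
  intro n F _ _ _ _ R₁ R₂ hR₁ hR₂ hne₁ hne₂
  dsimp only
  split_ifs with hlt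
  · exact uniformProb_nonneg _ _
  rw [not_lt] at hlt
  set m := ⌊α * n⌋₊ with hmdef
  have hm : 1 ≤ m := Nat.one_le_floor_iff (α * n) |>.2 hlt
  have hmn : (m : ℝ) ≤ α * n := Nat.floor_le (by positivity)
  have hmn' : α * n ≤ m + 1 := (Nat.lt_floor_add_one _).le
  have hn : 0 < n := by
    rcases Nat.eq_zero_or_pos n with rfl | h
    · norm_num at hlt
    · exact h
  have hN : (Nat.card (SparseVec F (Fin n) m) : ℝ) ≤ (Nat.card F : ℝ) ^ (δ ^ 2 / 40 * n) := by
    have h1 := hα (Fin n) m (Nat.card F) Finite.one_lt_card (by rwa [Fintype.card_fin])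
    rw [Fintype.card_fin] at h1
    refine le_trans ?_ h1
    exact_mod_cast card_sparseVec_le m
  refine le_uniformProb_isPairGood hn hm hδ₀ hδ₁ hδε hR₁ hR₂ hne₁ hne₂ hN ?_
  intro Q₁ hQ₁ Q₂ hQ₂ goodX goodZ r₁ r₂ HX₁ HZ₁ HX₂ HZ₂ hX₁ hZ₁ hX₂ hZ₂
  have hρ : α ^ 2 / 2 * (Fintype.card (Fin n) : ℝ) ^ 2 ≤ m * (m + 1) := by
    have hm' : (1 : ℝ) ≤ m := by exact_mod_cast hm
    rw [Fintype.card_fin]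
    calc α ^ 2 / 2 * (n : ℝ) ^ 2 = α * n / 2 * (α * n) := by ring
      _ ≤ m * (m + 1) := by gcongr; linarith
  have key := SSComplex.prod_properties hm goodX goodZ (ρ := α ^ 2 / 2) (by positivity) hρ₁ hρ
    hX₁ hZ₁ hX₂ hZ₂ rfl
  have hdim : (Q₁.dim * Q₂.dim : ℝ) = R₁ * R₂ * (n : ℝ) ^ 2 := by
    have hn' : (n : ℝ) ≠ 0 := by positivity
    rw [← hQ₁.2, ← hQ₂.2, CSSCode.rate, CSSCode.rate, Fintype.card_fin]
    field_simp
  rw [hdim, Fintype.card_fin] at key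
  exact key
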